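/- Let $A$ and $B$ be nonnegative selfadjoint operators in a complex Hilbert space $\mathcal H$, with domains $D[A]$ and $D[B]$, and assume that the operator sum $H = A+B$ is selfadjoint on $D[H] = D[A]\cap D[B]$. Then: (i) For every $L \ge 0$ there is a constant $C$ (depending on $A$, $B$, $L$) such that for all integers $n \ge 1$ and all $t \in [0,L]$, in operator norm, $$\bigl\|[e^{-tB/2n}e^{-tA/n}e^{-tB/2n}]^n - e^{-tH}\bigr\| \le \frac{C}{n}, \qquad \bigl\|[e^{-tA/n}e^{-tB/n}]^n - e^{-tH}\bigr\| \le \frac{C}{n}.$$ (ii) If moreover $H \ge \eta I$ for some $\eta > 0$, then there is a constant $C$ (depending on $A$, $B$) such that both inequalities hold for all integers $n \ge 1$ and all $t \in [0,\infty)$. (iii) The error bound $O(n^{-1})$ is optimal for both products: there exist a complex Hilbert space, unbounded nonnegative selfadjoint operators $A$, $B$ in it such that $H = A+B$ is selfadjoint on $D[A]\cap D[B]$, and a continuous function $c : [0,\infty) \to \mathbb R$ with $c(0)=0$ and $c(t)>0$ for $t>0$, such that for all integers $n \ge 1$ and all $t \ge 0$ $$\bigl\|[e^{-tB/2n}e^{-tA/n}e^{-tB/2n}]^n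 - e^{-tH}\bigr\| \ge \frac{c(t)}{n}, \qquad \bigl\|[e^{-tA/n}e^{-tB/n}]^n - e^{-tH}\bigr\| \ge \frac{c(t)}{n}.$$ -/

import Mathlib

open scoped InnerProductSpace

namespace TrotterProduct

section Definitions

variable {E : Type*} [NormedAddCommGroup E] [InnerProductSpace ℂ E] [CompleteSpace E]

/-- A (possibly unbounded) operator `A`, with domain `A.domain`, is a nonnegative selfadjoint
operator: `A` equals its adjoint (in particular it is densely defined) and `⟨A x, x⟩ ≥ 0` on its
domain. -/
structure IsNonnegSelfAdjoint (A : E →ₗ.[ℂ] E) : Prop where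
  isSelfAdjoint : IsSelfAdjoint A
  nonneg : ∀ x : A.domain, 0 ≤ (⟪A x, (x : E)⟫_ℂ).re

/-- `A` is bounded below by a positive multiple of the identity: `A ≥ η I` for some `η > 0`. -/
def HasPositiveLowerBound (A : E →ₗ.[ℂ] E) : Prop :=
  ∃ η : ℝ, 0 < η ∧ ∀ x : A.domain, η * ‖(x : E)‖ ^ 2 ≤ (⟪A x, (x : E)⟫_ℂ).re

/-- `A` is an unbounded operator. -/
def IsUnbounded (A : E →ₗ.[ℂ] E) : Prop :=
  ¬ ∃ C : ℝ, ∀ x : A.domain, ‖A x‖ ≤ C * ‖(x : E)‖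

/-- The bounded everywhere defined operator `R` is the inverse of `I + A : D[A] → E`. -/
def IsInvOneAdd (A : E →ₗ.[ℂ] E) (R : E →L[ℂ] E) : Prop :=
  ∀ x y : E, R x = y ↔ ∃ hy : y ∈ A.domain, y + A ⟨y, hy⟩ = x

open Classical in
/-- The bounded operator `(I + A)⁻¹`. It exists if `A` is nonnegative selfadjoint, see
`IsNonnegSelfAdjoint.isInvOneAdd_invOneAdd`; otherwise the value may be the placeholder `0`. -/
noncomputable def invOneAdd (A : E →ₗ.[ℂ] E) : E →L[ℂ] E :=
  if h : ∃ R : E →L[ℂ] E, IsInvOneAdd A R then h.choose else 0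

/-- The semigroup `e^{-tA}`, `t ≥ 0`, of a nonnegative selfadjoint operator `A`, by the functional
calculus. A number `a ≥ 0` in the spectrum of `A` corresponds to `x = (1 + a)⁻¹ ∈ (0, 1]` in the
spectrum of the bounded selfadjoint operator `R = (I + A)⁻¹`, and `e^{-ta} = e^{-t(x⁻¹ - 1)}`. For
`t > 0` this function of `x` extends continuously to `[0, 1]` by the value `0` at `x = 0`, and
`e^{-tA}` is the extended function applied to `R` (the kernel of `R` is zero, so that the value at
the point `x = 0` plays no role). For `t = 0` it is the identity. -/
noncomputable def expNeg (A : E →ₗ.[ℂ] E) (t : ℝ) : E →L[ℂ] E :=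
  if t = 0 then 1
  else cfc (fun x : ℝ => if x = 0 then 0 else Real.exp (-t * (x⁻¹ - 1))) (invOneAdd A)

/-- The symmetric Trotter product `[e^{-tB/2n} e^{-tA/n} e^{-tB/2n}]^n`. -/
noncomputable def symmProduct (A B : E →ₗ.[ℂ] E) (n : ℕ) (t : ℝ) : E →L[ℂ] E :=
  (expNeg B (t / (2 * n)) * expNeg A (t / n) * expNeg B (t / (2 * n))) ^ n

/-- The nonsymmetric Trotter product `[e^{-tA/n} e^{-tB/n}]^n`. -/
noncomputable def nonsymmProduct (A B : E →ₗ.[ℂ] E) (n : ℕ) (t : ℝ) : E →L[ℂ] E :=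
  (expNeg A (t / n) * expNeg B (t / n)) ^ n

theorem IsNonnegSelfAdjoint.norm_le {A : E →ₗ.[ℂ] E} (hA : IsNonnegSelfAdjoint A)
    (x : A.domain) : ‖(x : E)‖ ≤ ‖(x : E) + A x‖ := by
  have h1 := hA.nonneg x
  have h2 : (⟪(x : E) + A x, (x : E)⟫_ℂ).re ≤ ‖(x : E) + A x‖ * ‖(x : E)‖ :=
    (Complex.re_le_norm _).trans (norm_inner_le_norm _ _)
  rw [inner_add_left, Complex.add_re] at h2
  have h3 : (⟪(x : E), (x : E)⟫_ℂ).re = ‖(x : E)‖ ^ 2 := by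
    simpa using inner_self_eq_norm_sq (𝕜 := ℂ) (x : E)
  by_contra hlt
  push Not at hlt
  nlinarith [norm_nonneg ((x : E) + A x)]

theorem IsNonnegSelfAdjoint.exists_isInvOneAdd {A : E →ₗ.[ℂ] E} (hA : IsNonnegSelfAdjoint A) :
    ∃ R : E →L[ℂ] E, IsInvOneAdd A R := by
  have hd : Dense (A.domain : Set E) := hA.isSelfAdjoint.dense_domain
  have hadj : A.adjoint = A := hA.isSelfAdjoint
  have hcl : A.IsClosed := hA.isSelfAdjoint.isClosed
  let T : A.domain →ₗ[ℂ] E := A.domain.subtype + A.toFun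
  have hT : ∀ x : A.domain, T x = (x : E) + A x := fun x => rfl
  have hn : ∀ x : A.domain, ‖(x : E)‖ ≤ ‖T x‖ := hA.norm_le
  have hinj : Function.Injective T := by
    rw [← LinearMap.ker_eq_bot, LinearMap.ker_eq_bot']
    intro x hx
    have := hn x
    rw [hx, norm_zero] at this
    exact Subtype.ext (norm_le_zero_iff.mp this)
  have hclosed : IsClosed (LinearMap.range T : Set E) := by
    rw [← isSeqClosed_iff_isClosed]
    intro u y hu huy
    choose x hx using hu
    have hc : CauchySeq (fun n => (x n : E)) := by
      have hcu := huy.cauchySeq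
      rw [Metric.cauchySeq_iff] at hcu ⊢
      intro ε hε
      obtain ⟨N, hN⟩ := hcu ε hε
      refine ⟨N, fun m hm n hn' => lt_of_le_of_lt ?_ (hN m hm n hn')⟩
      rw [dist_eq_norm, dist_eq_norm, ← hx, ← hx, ← map_sub]
      simpa using hn (x m - x n)
    obtain ⟨z, hz⟩ := cauchySeq_tendsto_of_complete hc
    have hAz : Filter.Tendsto (fun n => A (x n)) Filter.atTop (nhds (y - z)) := by
      refine (huy.sub hz).congr fun n => ?_
      rw [← hx, hT]; simp
    have hmem : (z, y - z) ∈ A.graph := by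
      refine hcl.mem_of_tendsto (hz.prodMk_nhds hAz) (Filter.Eventually.of_forall fun n => ?_)
      exact A.mem_graph (x n)
    rw [LinearPMap.mem_graph_iff] at hmem
    obtain ⟨w, hw1, hw2⟩ := hmem
    exact ⟨w, by rw [hT, hw2, hw1]; simp⟩
  have hsurj : Function.Surjective T := by
    rw [← LinearMap.range_eq_top]
    have : (LinearMap.range T).HasOrthogonalProjection := by
      have := hclosed.completeSpace_coe
      infer_instance
    rw [← Submodule.orthogonal_eq_bot_iff, Submodule.eq_bot_iff]
    intro y hy
    have hy' : ∀ x : A.domain, ⟪y, A x⟫_ℂ = ⟪-y, (x : E)⟫_ℂ := by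
      intro x
      have := Submodule.inner_left_of_mem_orthogonal (LinearMap.mem_range_self T x) hy
      rw [hT, inner_add_right] at this
      rw [inner_neg_left]
      linear_combination this
    have hyd : y ∈ A.adjoint.domain :=
      LinearPMap.mem_adjoint_domain_of_exists y ⟨-y, fun x => (hy' x).symm⟩
    have hay : A.adjoint ⟨y, hyd⟩ = -y :=
      LinearPMap.adjoint_apply_eq hd ⟨y, hyd⟩ fun x => (hy' x).symm
    have hg : (y, -y) ∈ A.graph := by
      rw [← hadj, ← hay]
      exact A.adjoint.mem_graph ⟨y, hyd⟩
    rw [LinearPMap.mem_graph_iff] at hg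
    obtain ⟨w, hw1, hw2⟩ := hg
    have := hn w
    rw [hT, hw2, hw1] at this
    simpa using this
  let e := LinearEquiv.ofBijective T ⟨hinj, hsurj⟩
  have he : ∀ x, T (e.symm x) = x := fun x => e.apply_symm_apply x
  refine ⟨(A.domain.subtype ∘ₗ e.symm.toLinearMap).mkContinuous 1 fun x => ?_, fun x y => ?_⟩
  · have := hn (e.symm x)
    rw [he] at this
    simpa using this
  · constructor
    · rintro rfl
      exact ⟨(e.symm x).2, he x⟩
    · rintro ⟨hy, rfl⟩
      have : e.symm (y + A ⟨y, hy⟩) = ⟨y, hy⟩ := e.symm_apply_apply ⟨y, hy⟩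
      simp [this]

/-- For a nonnegative selfadjoint `A`, the operator `invOneAdd A` is the inverse of `I + A`. -/
theorem IsNonnegSelfAdjoint.isInvOneAdd_invOneAdd {A : E →ₗ.[ℂ] E}
    (hA : IsNonnegSelfAdjoint A) : IsInvOneAdd A (invOneAdd A) := by
  rw [invOneAdd, dif_pos hA.exists_isInvOneAdd]
  exact hA.exists_isInvOneAdd.choose_spec

end Definitions

end TrotterProduct

/-! Upper bounds. With τ = t/n, F = e^{-τB/2}e^{-τA}e^{-τB/2} and G = e^{-τH} are positive
contractions. If F - G = (1-F)Δ(1-G), then ‖F^n - G^n‖ ≤ 40‖Δ‖/n: after summation by parts in the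
telescoping sum each term carries (1-F)², and F^p(1-F)² = O(n⁻²) for p of order n
(`norm_pow_sub_pow_le_div`). Hence Δ has to be bounded uniformly in τ. With K_T = 1 + τ⁻¹(1-T) one
has F - G = τ K_F (K_F⁻¹ - K_G⁻¹) K_G, so the task is to show K_F⁻¹ - K_G⁻¹ = O(τ) and to convert
the factors K into factors 1 - F and 1 - G.

The resolvent estimate is `norm_resolvent_sub_le`. Selfadjointness of H on D[A] ∩ D[B] makes
(1+A)(1+H)⁻¹ and (1+B)(1+H)⁻¹ bounded by the closed graph theorem. The resolvent difference is then
a linear term, smoothed by (1+H)⁻¹ on both sides, plus a quadratic one, in which K_F^{-1/2} gains √τ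
on each side.

The factors K are converted on [0,L] by rescaling F and G by (1+τ)⁻¹, at the cost of (1+τ)^n ≤
e^{nτ}. If H ≥ η > 0, they are converted by inverting 1 - K_F⁻¹ and 1 - K_G⁻¹ for small τ; for large
τ both norms stay below some q < 1 and the powers decay geometrically. The nonsymmetric product
reduces to the symmetric one by regrouping its factors (`norm_nonsymm_pow_sub_pow_le`).

Optimality. A and B are direct sums of 2×2 blocks k·aa* and k·bb*, where a, b = (±σ, √(1-σ²)). Since
kσ ≤ 1, A - B is bounded and A + B is selfadjoint on the common domain. All admissible pairs (k,σ)
occur, so that one space serves every t and n. With kτ = 4 log 2 and σ of order 1/n, one step has an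
eigenvalue l ≥ 1 - 4σ², whereas e^{-τH} has the eigenvalue exp(-8 log 2 · σ²), about 1 - 5.5σ². The
n-th powers then differ by at least nσ²/2, which is of order 1/n. -/

open scoped InnerProductSpace

namespace TrotterProduct

/-! ### Powers of two positive contractions -/

section Chernoff

/-- The geometric sum (1-x)(1 + x + ... + x^n) = 1 - x^{n+1} has n + 1 terms, the last of which is
the smallest. -/
theorem pow_mul_one_sub_le {x : ℝ} (h0 : 0 ≤ x) (h1 : x ≤ 1) (n : ℕ) :
    x ^ n * (1 - x) ≤ 1 / (n + 1) := by
  have key : ∀ n : ℕ, (n + 1) * (x ^ n * (1 - x)) ≤ 1 - x ^ (n + 1) := by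
    intro n
    induction n with
    | zero => simp
    | succ n ih =>
      have h2 : 0 ≤ (1 - x) * (1 - x ^ (n + 1)) :=
        mul_nonneg (by linarith) (by linarith [pow_le_one₀ h0 h1 (n := n + 1)])
      have h3 := mul_le_mul_of_nonneg_left ih h0
      push_cast
      rw [pow_succ x (n + 1)]
      rw [pow_succ] at h2 h3 ⊢
      nlinarith
  rw [le_div_iff₀ (by positivity)]
  have := key n
  have := pow_nonneg h0 (n + 1)
  linarith

variable {𝓐 : Type*} [CStarAlgebra 𝓐] [PartialOrder 𝓐] [StarOrderedRing 𝓐]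

theorem spectrum_subset_Icc {a : 𝓐} (h0 : 0 ≤ a) (h1 : a ≤ 1) :
    spectrum ℝ a ⊆ Set.Icc 0 1 := by
  intro x hx
  refine ⟨spectrum_nonneg_of_nonneg h0 hx, ?_⟩
  have h1' : a ≤ algebraMap ℝ 𝓐 1 := by simpa using h1
  exact (le_algebraMap_iff_spectrum_le (ha := IsSelfAdjoint.of_nonneg h0)).1 h1' x hx

theorem norm_le_one_of_nonneg_of_le_one {a : 𝓐} (h0 : 0 ≤ a) (h1 : a ≤ 1) : ‖a‖ ≤ 1 :=
  (CStarAlgebra.norm_le_one_iff_of_nonneg a h0).2 h1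

theorem norm_pow_mul_one_sub_le {a : 𝓐} (h0 : 0 ≤ a) (h1 : a ≤ 1) (n : ℕ) :
    ‖a ^ n * (1 - a)‖ ≤ 1 / (n + 1) := by
  have ha : IsSelfAdjoint a := IsSelfAdjoint.of_nonneg h0
  have e : a ^ n * (1 - a) = cfc (fun x : ℝ => x ^ n * (1 - x)) a := by
    rw [cfc_mul (fun x : ℝ => x ^ n) (fun x : ℝ => 1 - x) a, cfc_pow_id (R := ℝ) a n,
      cfc_sub (fun _ : ℝ => (1 : ℝ)) (fun x => x) a, cfc_const_one ℝ a, cfc_id' ℝ a]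
  rw [e]
  refine norm_cfc_le (by positivity) fun x hx => ?_
  obtain ⟨hx0, hx1⟩ := spectrum_subset_Icc h0 h1 hx
  rw [Real.norm_of_nonneg (mul_nonneg (pow_nonneg hx0 n) (by linarith))]
  exact pow_mul_one_sub_le hx0 hx1 n

variable {F G Δ : 𝓐} {c : ℝ}

/-- One half of the comparison of powers of two positive contractions. -/
theorem norm_pow_mul_pow_sub_pow_le (hF0 : 0 ≤ F) (hF1 : F ≤ 1) (hG0 : 0 ≤ G) (hG1 : G ≤ 1)
    (h : F - G = (1 - F) * Δ * (1 - G)) (hΔ : ‖Δ‖ ≤ c) (p m : ℕ) :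
    ‖F ^ p * (F ^ m - G ^ m)‖ ≤
      c * (2 * ‖F ^ p * (1 - F)‖ + m * ‖F ^ p * (1 - F) * (1 - F)‖) := by
  have hF := norm_le_one_of_nonneg_of_le_one hF0 hF1
  have hG := norm_le_one_of_nonneg_of_le_one hG0 hG1
  have hc : 0 ≤ c := (norm_nonneg _).trans hΔ
  have hGm : ∀ m, ‖Δ * G ^ m‖ ≤ c := fun m => by
    refine (norm_mul_le _ _).trans ?_
    rcases m.eq_zero_or_pos with rfl | hm
    · rcases subsingleton_or_nontrivial 𝓐 with h' | h'
      · rw [Subsingleton.elim Δ 0]; simpa using hc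
      · simpa using hΔ
    · calc ‖Δ‖ * ‖G ^ m‖ ≤ c * 1 := by
            gcongr
            exact (norm_pow_le' G hm).trans (pow_le_one₀ (norm_nonneg _) hG)
        _ = c := mul_one c
  -- Summation by parts. `V m` collects F^{m-1-j}(1-F)ΔG^j over j < m together with F^mΔ, so the
  -- factor 1 - G of the telescoping sum is traded for a second factor 1 - F.
  obtain ⟨V, hV, hV'⟩ : ∃ V : ℕ → 𝓐, (∀ m, F ^ m - G ^ m = (1 - F) * (V m - Δ * G ^ m)) ∧
      ∀ m, ‖F ^ p * (1 - F) * V m‖ ≤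
        c * (‖F ^ p * (1 - F)‖ + m * ‖F ^ p * (1 - F) * (1 - F)‖) := by
    refine ⟨fun m => Nat.rec Δ (fun m V => F * V + (1 - F) * (Δ * G ^ m)) m, fun m => ?_,
      fun m => ?_⟩
    · induction m with
      | zero => simp
      | succ m ih =>
        have e1 : F ^ (m + 1) - G ^ (m + 1) = F * (F ^ m - G ^ m) + (F - G) * G ^ m := by
          rw [pow_succ', pow_succ']; noncomm_ring
        rw [e1, ih, h]
        simp only
        rw [pow_succ' G m]
        noncomm_ring
    · induction m with
      | zero =>
        simp only [Nat.cast_zero, zero_mul, add_zero]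
        rw [mul_comm c]
        exact (norm_mul_le _ _).trans (mul_le_mul_of_nonneg_left hΔ (norm_nonneg _))
      | succ m ih =>
        simp only
        set W : 𝓐 := Nat.rec Δ (fun m V => F * V + (1 - F) * (Δ * G ^ m)) m
        have e1 : F ^ p * (1 - F) * (F * W + (1 - F) * (Δ * G ^ m)) =
            F * (F ^ p * (1 - F) * W) + F ^ p * (1 - F) * (1 - F) * (Δ * G ^ m) := by
          have hcm : Commute (F ^ p * (1 - F)) F :=
            ((Commute.refl F).pow_left p).mul_left
              ((Commute.one_left F).sub_left (Commute.refl F))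
          rw [mul_add, ← mul_assoc _ F, hcm.eq]
          simp only [mul_assoc]
        rw [e1]
        calc _ ≤ ‖F‖ * ‖F ^ p * (1 - F) * W‖ + ‖F ^ p * (1 - F) * (1 - F)‖ * ‖Δ * G ^ m‖ :=
              (norm_add_le _ _).trans (add_le_add (norm_mul_le _ _) (norm_mul_le _ _))
          _ ≤ 1 * (c * (‖F ^ p * (1 - F)‖ + m * ‖F ^ p * (1 - F) * (1 - F)‖)) +
              ‖F ^ p * (1 - F) * (1 - F)‖ * c := by
              gcongr
              exact hGm m
          _ = _ := by push_cast; ring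
  rw [hV m, ← mul_assoc, mul_sub]
  calc _ ≤ c * (‖F ^ p * (1 - F)‖ + m * ‖F ^ p * (1 - F) * (1 - F)‖) +
        ‖F ^ p * (1 - F)‖ * c := by
        refine (norm_sub_le _ _).trans (add_le_add (hV' m) ((norm_mul_le _ _).trans ?_))
        gcongr
        exact hGm m
    _ = _ := by ring

/-- Splitting p into two halves, one for each factor 1 - F, gives F^p(1-F)² = O(n⁻²), which
outweighs the factor m ≤ n. -/
theorem norm_pow_mul_pow_sub_pow_le_div (hF0 : 0 ≤ F) (hF1 : F ≤ 1) (hG0 : 0 ≤ G) (hG1 : G ≤ 1)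
    (h : F - G = (1 - F) * Δ * (1 - G)) (hΔ : ‖Δ‖ ≤ c) {p m n : ℕ} (hn : 1 ≤ n)
    (hp : n ≤ 2 * p + 1) (hm : m ≤ n) :
    ‖F ^ p * (F ^ m - G ^ m)‖ ≤ 20 * c / n := by
  have hF := norm_le_one_of_nonneg_of_le_one hF0 hF1
  have hc : 0 ≤ c := (norm_nonneg _).trans hΔ
  have hn0 : (0 : ℝ) < n := by exact_mod_cast hn
  obtain ⟨r, s, hrs, hr, hs⟩ : ∃ r s, p = r + s ∧ n ≤ 4 * (r + 1) ∧ n ≤ 4 * (s + 1) :=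
    ⟨p / 2, p - p / 2, by omega, by omega, by omega⟩
  have hr' : (n : ℝ) ≤ 4 * (r + 1) := by exact_mod_cast hr
  have hs' : (n : ℝ) ≤ 4 * (s + 1) := by exact_mod_cast hs
  have hp' : (n : ℝ) ≤ 2 * (p + 1) := by
    have : n ≤ 2 * (p + 1) := by omega
    exact_mod_cast this
  have b1 : ‖F ^ p * (1 - F)‖ ≤ 2 / n := by
    refine (norm_pow_mul_one_sub_le hF0 hF1 p).trans ?_
    rw [div_le_div_iff₀ (by positivity) hn0]; linarith
  have b2 : ‖F ^ p * (1 - F) * (1 - F)‖ ≤ (4 / n) * (4 / n) := by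
    have e : F ^ p * (1 - F) * (1 - F) = (F ^ r * (1 - F)) * (F ^ s * (1 - F)) := by
      have hcm : Commute (F ^ s) (1 - F) :=
        (Commute.one_right _).sub_right ((Commute.refl F).pow_left s)
      rw [hrs, pow_add, mul_assoc (F ^ r) (1 - F), ← mul_assoc (1 - F) (F ^ s), ← hcm.eq]
      simp only [mul_assoc]
    rw [e]
    refine (norm_mul_le _ _).trans ?_
    gcongr
    · refine (norm_pow_mul_one_sub_le hF0 hF1 r).trans ?_
      rw [div_le_div_iff₀ (by positivity) hn0]; linarith
    · refine (norm_pow_mul_one_sub_le hF0 hF1 s).trans ?_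
      rw [div_le_div_iff₀ (by positivity) hn0]; linarith
  refine (norm_pow_mul_pow_sub_pow_le hF0 hF1 hG0 hG1 h hΔ p m).trans ?_
  have hm' : (m : ℝ) ≤ n := by exact_mod_cast hm
  calc _ ≤ c * (2 * (2 / n) + n * ((4 / n) * (4 / n))) := by gcongr
    _ = 20 * c / n := by field_simp; ring

/-- Comparison of the powers of two positive contractions. -/
theorem norm_pow_sub_pow_le_div (hF0 : 0 ≤ F) (hF1 : F ≤ 1) (hG0 : 0 ≤ G) (hG1 : G ≤ 1)
    (h : F - G = (1 - F) * Δ * (1 - G)) (hΔ : ‖Δ‖ ≤ c) {n : ℕ} (hn : 1 ≤ n) :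
    ‖F ^ n - G ^ n‖ ≤ 40 * c / n := by
  have hFs : IsSelfAdjoint F := IsSelfAdjoint.of_nonneg hF0
  have hGs : IsSelfAdjoint G := IsSelfAdjoint.of_nonneg hG0
  -- Half of the power smooths on the left with F, the other half on the right with G. The second
  -- term is the adjoint of one of the first kind with F and G exchanged and -Δ* in place of Δ.
  obtain ⟨p, m, hpm, hp, hm⟩ : ∃ p m, n = p + m ∧ n ≤ 2 * p + 1 ∧ n ≤ 2 * m + 1 :=
    ⟨n / 2, n - n / 2, by omega, by omega, by omega⟩
  have e : F ^ n - G ^ n = F ^ p * (F ^ m - G ^ m) + (F ^ p - G ^ p) * G ^ m := by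
    rw [hpm, pow_add, pow_add]; noncomm_ring
  have e2 : (F ^ p - G ^ p) * G ^ m = -star (G ^ m * (G ^ p - F ^ p)) := by
    rw [star_mul, star_sub, star_pow, star_pow, star_pow, hFs.star_eq, hGs.star_eq]
    noncomm_ring
  have h' : G - F = (1 - G) * (-star Δ) * (1 - F) := by
    have := congrArg star h
    simp only [star_sub, star_mul, star_one, hFs.star_eq, hGs.star_eq] at this
    rw [mul_neg, neg_mul, mul_assoc, ← this, neg_sub]
  rw [e, e2]
  refine (norm_add_le _ _).trans ?_
  rw [norm_neg, norm_star]
  calc _ ≤ 20 * c / n + 20 * c / n := add_le_add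
        (norm_pow_mul_pow_sub_pow_le_div hF0 hF1 hG0 hG1 h hΔ hn hp (by omega))
        (norm_pow_mul_pow_sub_pow_le_div hG0 hG1 hF0 hF1 h' (by rwa [norm_neg, norm_star])
          hn hm (by omega))
    _ = 40 * c / n := by ring

end Chernoff

/-! ### The scalar function behind the semigroup and its first order error -/

section ExpFunction

/-- The function of `(1 + a)⁻¹` whose value is `e^{-ta}`. -/
noncomputable def expFun (t x : ℝ) : ℝ := if x = 0 then 0 else Real.exp (-t * (x⁻¹ - 1))

theorem expFun_zero (t : ℝ) : expFun t 0 = 0 := if_pos rfl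

theorem expFun_of_ne_zero (t : ℝ) {x : ℝ} (hx : x ≠ 0) :
    expFun t x = Real.exp (-t * (x⁻¹ - 1)) := if_neg hx

theorem expFun_nonneg (t x : ℝ) : 0 ≤ expFun t x := by
  rw [expFun]; split_ifs <;> positivity

theorem expFun_add (s t x : ℝ) : expFun (s + t) x = expFun s x * expFun t x := by
  rcases eq_or_ne x 0 with rfl | hx
  · simp [expFun_zero]
  · rw [expFun_of_ne_zero _ hx, expFun_of_ne_zero _ hx, expFun_of_ne_zero _ hx, ← Real.exp_add]
    ring_nf

theorem expFun_le_one {t : ℝ} (ht : 0 ≤ t) {x : ℝ} (hx : x ∈ Set.Icc (0 : ℝ) 1) :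
    expFun t x ≤ 1 := by
  rcases eq_or_ne x 0 with rfl | h
  · simp [expFun_zero]
  · rw [expFun_of_ne_zero _ h, Real.exp_le_one_iff]
    have : 1 ≤ x⁻¹ := (one_le_inv₀ (lt_of_le_of_ne hx.1 h.symm)).2 hx.2
    nlinarith

theorem continuousAt_expFun (t : ℝ) {x : ℝ} (hx : x ≠ 0) : ContinuousAt (expFun t) x := by
  have : (fun x : ℝ => Real.exp (-t * (x⁻¹ - 1))) =ᶠ[nhds x] expFun t := by
    filter_upwards [isOpen_ne.mem_nhds hx] with y hy
    rw [expFun_of_ne_zero _ hy]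
  refine ContinuousAt.congr ?_ this
  fun_prop (disch := assumption)

theorem continuousOn_expFun {t : ℝ} (ht : 0 < t) : ContinuousOn (expFun t) (Set.Icc 0 1) := by
  intro x hx
  rcases eq_or_ne x 0 with rfl | h
  · rw [ContinuousWithinAt, expFun_zero]
    -- For y > 0 the value is e^t e^{-t/y}, and e^{t/y} ≥ t/y gives the linear majorant (e^t/t)y.
    refine tendsto_of_tendsto_of_tendsto_of_le_of_le' (g := fun _ => (0 : ℝ))
      (h := fun x => Real.exp t / t * x) tendsto_const_nhds ?_ ?_ ?_
    · have : Filter.Tendsto (fun x : ℝ => Real.exp t / t * x) (nhds 0)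
          (nhds (Real.exp t / t * 0)) := by
        exact (continuous_const.mul continuous_id).tendsto 0
      rw [mul_zero] at this
      exact this.mono_left nhdsWithin_le_nhds
    · exact Filter.Eventually.of_forall fun x => expFun_nonneg t x
    · filter_upwards [self_mem_nhdsWithin] with y hy
      rcases eq_or_ne y 0 with rfl | h'
      · simp [expFun_zero]
      · have hy0 : 0 < y := lt_of_le_of_ne hy.1 h'.symm
        rw [expFun_of_ne_zero _ h']
        have e : -t * (y⁻¹ - 1) = t - t / y := by field_simp; ring
        rw [e, Real.exp_sub, div_mul_eq_mul_div, div_le_div_iff₀ (Real.exp_pos _) ht]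
        have h1 : t / y ≤ Real.exp (t / y) := by linarith [Real.add_one_le_exp (t / y)]
        have h2 : t ≤ y * Real.exp (t / y) := by
          calc t = y * (t / y) := by field_simp
            _ ≤ _ := by gcongr
        have := mul_le_mul_of_nonneg_left h2 (Real.exp_pos t).le
        linarith
  · exact (continuousAt_expFun t h).continuousWithinAt

variable {t x : ℝ}

theorem one_sub_expFun_mul_le (ht : 0 < t) (hx : x ∈ Set.Icc (0 : ℝ) 1) :
    (1 - expFun t x) * x ≤ t := by
  rcases eq_or_ne x 0 with rfl | h
  · simpa using ht.le
  · have hx0 : 0 < x := lt_of_le_of_ne hx.1 h.symm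
    rw [expFun_of_ne_zero _ h]
    have h1 := Real.add_one_le_exp (-t * (x⁻¹ - 1))
    calc (1 - Real.exp (-t * (x⁻¹ - 1))) * x ≤ (t * (x⁻¹ - 1)) * x := by
          gcongr; linarith
      _ = t * (1 - x) := by field_simp
      _ ≤ t := by nlinarith [hx.1]

/-- The error `(a - t⁻¹ (1 - e^{-ta})) / (1 + a)` in the variable `x = (1 + a)⁻¹`. -/
noncomputable def errFun (t x : ℝ) : ℝ := 1 - x - t⁻¹ * ((1 - expFun t x) * x)

/-- With y = t(x⁻¹ - 1) the error is (x/t)(y - 1 + e^{-y}), where (x/t)y = 1 - x ≤ 1. Both upper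
bounds follow from y - 1 + e^{-y} ≤ y(1 - e^{-y}) ≤ y². The first one makes the square of the error
operator at most 1 - e^{-tA}, the second makes it O(t) after smoothing by (1+A)⁻¹. -/
theorem errFun_bounds (ht : 0 < t) (hx : x ∈ Set.Icc (0 : ℝ) 1) :
    0 ≤ errFun t x ∧ errFun t x ≤ 1 - expFun t x ∧ x * errFun t x ≤ t := by
  rw [errFun]
  rcases eq_or_ne x 0 with rfl | h
  · simp [expFun_zero, ht.le]
  · have hx0 : 0 < x := lt_of_le_of_ne hx.1 h.symm
    rw [expFun_of_ne_zero _ h]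
    obtain ⟨y, hy⟩ : ∃ y, y = t * (x⁻¹ - 1) := ⟨_, rfl⟩
    have hy0 : 0 ≤ y := by
      have : 1 ≤ x⁻¹ := (one_le_inv₀ hx0).2 hx.2
      rw [hy]; exact mul_nonneg ht.le (by linarith)
    have hxy : 1 - x = x / t * y := by rw [hy]; field_simp
    have e : 1 - x - t⁻¹ * ((1 - Real.exp (-t * (x⁻¹ - 1))) * x) =
        x / t * (y - 1 + Real.exp (-y)) := by
      rw [hxy, neg_mul, ← hy]; field_simp; ring
    have h1 : 0 ≤ y - 1 + Real.exp (-y) := by linarith [Real.add_one_le_exp (-y)]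
    have h2 : y - 1 + Real.exp (-y) ≤ y * (1 - Real.exp (-y)) := by
      have h3 : (1 + y) * Real.exp (-y) ≤ 1 := by
        have := mul_le_mul_of_nonneg_right (Real.add_one_le_exp y) (Real.exp_pos (-y)).le
        rw [← Real.exp_add, add_neg_cancel, Real.exp_zero] at this
        linarith
      linarith
    have h3 : 1 - Real.exp (-y) ≤ y := by linarith [Real.add_one_le_exp (-y)]
    have h4 : 0 ≤ 1 - Real.exp (-y) := by
      have : Real.exp (-y) ≤ 1 := Real.exp_le_one_iff.2 (by linarith)
      linarith
    have hxt : 0 < x / t := by positivity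
    rw [e, neg_mul, ← hy]
    refine ⟨by positivity, ?_, ?_⟩
    · calc x / t * (y - 1 + Real.exp (-y)) ≤ x / t * (y * (1 - Real.exp (-y))) := by gcongr
        _ = (1 - x) * (1 - Real.exp (-y)) := by rw [hxy]; ring
        _ ≤ 1 - Real.exp (-y) := by nlinarith [hx.1]
    · calc x * (x / t * (y - 1 + Real.exp (-y))) ≤ x * (x / t * (y * y)) := by
            have : y * (1 - Real.exp (-y)) ≤ y * y := by gcongr
            gcongr; linarith
        _ = t * ((1 - x) * (1 - x)) := by rw [hxy]; field_simp
        _ ≤ t * (1 * 1) := by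
            have := hx.1; have := hx.2
            gcongr <;> linarith
        _ = t := by ring

end ExpFunction

/-! ### One semigroup step in a C⋆-algebra -/

section Step

variable {𝓐 : Type*} [CStarAlgebra 𝓐] [PartialOrder 𝓐] [StarOrderedRing 𝓐]

/-- The difference of `A` and `t⁻¹ (1 - a)`, multiplied from the right by `X = (1 + A)⁻¹`. -/
noncomputable def stepErr (t : ℝ) (X a : 𝓐) : 𝓐 := 1 - X - t⁻¹ • ((1 - a) * X)

/-- The properties of `X = (1 + A)⁻¹` and `a = e^{-tA}` that are used in the resolvent
estimate. -/
structure IsStep (t : ℝ) (X a : 𝓐) : Prop where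
  nonneg : 0 ≤ a
  le_one : a ≤ 1
  isSelfAdjoint : IsSelfAdjoint X
  norm_one_sub_mul_le : ‖(1 - a) * X‖ ≤ t
  isSelfAdjoint_stepErr : IsSelfAdjoint (stepErr t X a)
  stepErr_mul_self_le : stepErr t X a * stepErr t X a ≤ 1 - a
  norm_mul_stepErr_le : ‖X * stepErr t X a‖ ≤ t

/-- This is the step of the zero operator. It lets the resolvent estimate for two operators apply to
a single semigroup. -/
theorem isStep_one {t : ℝ} (ht : 0 < t) : IsStep t (1 : 𝓐) 1 := by
  have h : stepErr t (1 : 𝓐) 1 = 0 := by simp [stepErr]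
  exact ⟨zero_le_one, le_rfl, .one _, by simpa using ht.le, by simp [h], by simp [h],
    by simpa [h] using ht.le⟩

theorem isStep_cfc {X : 𝓐} (h0 : 0 ≤ X) (h1 : X ≤ 1) {t : ℝ} (ht : 0 < t) :
    IsStep t X (cfc (expFun t) X) := by
  have hX : IsSelfAdjoint X := IsSelfAdjoint.of_nonneg h0
  have hs := spectrum_subset_Icc h0 h1
  have hf : ContinuousOn (expFun t) (spectrum ℝ X) := (continuousOn_expFun ht).mono hs
  have e1 : 1 - cfc (expFun t) X = cfc (fun x => 1 - expFun t x) X := by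
    rw [cfc_sub (fun _ => (1 : ℝ)) (expFun t) X, cfc_const_one ℝ X]
  have hf1 : ContinuousOn (fun x => 1 - expFun t x) (spectrum ℝ X) := by fun_prop
  have e2 : (1 - cfc (expFun t) X) * X = cfc (fun x => (1 - expFun t x) * x) X := by
    rw [e1, cfc_mul (fun x => 1 - expFun t x) (fun x => x) X, cfc_id' ℝ X]
  have e3 : stepErr t X (cfc (expFun t) X) = cfc (errFun t) X := by
    have : errFun t = fun x => (1 - x) - t⁻¹ • ((1 - expFun t x) * x) := rfl
    rw [stepErr, e2, this, cfc_sub (fun x => 1 - x) (fun x => t⁻¹ • ((1 - expFun t x) * x)) X,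
      cfc_sub (fun _ => (1 : ℝ)) (fun x => x) X, cfc_const_one ℝ X, cfc_id' ℝ X,
      cfc_smul t⁻¹ (fun x => (1 - expFun t x) * x) X]
  have hf2 : ContinuousOn (errFun t) (spectrum ℝ X) := by
    unfold errFun; fun_prop
  refine ⟨cfc_nonneg fun x _ => expFun_nonneg t x, ?_, hX, ?_, ?_, ?_, ?_⟩
  · exact cfc_le_one _ _ fun x hx => expFun_le_one ht.le (hs hx)
  · rw [e2]
    refine norm_cfc_le ht.le fun x hx => ?_
    rw [Real.norm_of_nonneg (mul_nonneg (by linarith [expFun_le_one ht.le (hs hx)]) (hs hx).1)]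
    exact one_sub_expFun_mul_le ht (hs hx)
  · rw [e3]; exact cfc_predicate _ _
  · rw [e3, e1, ← cfc_mul (errFun t) (errFun t) X]
    refine cfc_mono fun x hx => ?_
    obtain ⟨b0, b1, -⟩ := errFun_bounds ht (hs hx)
    have := expFun_nonneg t x
    nlinarith
  · have e4 : X * cfc (errFun t) X = cfc (fun x => x * errFun t x) X := by
      rw [cfc_mul (fun x => x) (errFun t) X, cfc_id' ℝ X]
    rw [e3, e4]
    refine norm_cfc_le ht.le fun x hx => ?_
    obtain ⟨b0, -, b2⟩ := errFun_bounds ht (hs hx)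
    rw [Real.norm_of_nonneg (mul_nonneg (hs hx).1 b0)]
    exact b2

end Step

/-! ### The resolvent and the semigroup of a nonnegative selfadjoint operator -/

section Semigroup

variable {E : Type*} [NormedAddCommGroup E] [InnerProductSpace ℂ E] [CompleteSpace E]
  {A : E →ₗ.[ℂ] E}

theorem IsNonnegSelfAdjoint.inner_apply (hA : IsNonnegSelfAdjoint A) (x y : A.domain) :
    ⟪A x, (y : E)⟫_ℂ = ⟪(x : E), A y⟫_ℂ := by
  have hadj : A.adjoint = A := hA.isSelfAdjoint
  have := A.adjoint_isFormalAdjoint hA.isSelfAdjoint.dense_domain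
  rw [hadj] at this
  exact (this x y)

theorem IsNonnegSelfAdjoint.exists_invOneAdd_apply (hA : IsNonnegSelfAdjoint A) (f : E) :
    ∃ u : A.domain, invOneAdd A f = u ∧ f = u + A u := by
  obtain ⟨hy, h⟩ := (hA.isInvOneAdd_invOneAdd f _).1 rfl
  exact ⟨⟨_, hy⟩, rfl, h.symm⟩

theorem IsNonnegSelfAdjoint.invOneAdd_add_apply (hA : IsNonnegSelfAdjoint A) (u : A.domain) :
    invOneAdd A (u + A u) = u :=
  (hA.isInvOneAdd_invOneAdd _ _).2 ⟨u.2, rfl⟩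

theorem IsNonnegSelfAdjoint.invOneAdd_injective (hA : IsNonnegSelfAdjoint A) :
    Function.Injective (invOneAdd A) := by
  intro f g h
  obtain ⟨u, hu, rfl⟩ := hA.exists_invOneAdd_apply f
  obtain ⟨v, hv, rfl⟩ := hA.exists_invOneAdd_apply g
  have : u = v := Subtype.ext (by rw [← hu, ← hv, h])
  rw [this]

theorem IsNonnegSelfAdjoint.isSymmetric_invOneAdd (hA : IsNonnegSelfAdjoint A) (f g : E) :
    ⟪invOneAdd A f, g⟫_ℂ = ⟪f, invOneAdd A g⟫_ℂ := by
  obtain ⟨u, hu, rfl⟩ := hA.exists_invOneAdd_apply f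
  obtain ⟨v, hv, rfl⟩ := hA.exists_invOneAdd_apply g
  rw [hu, hv, inner_add_right, inner_add_left, hA.inner_apply]

theorem IsNonnegSelfAdjoint.invOneAdd_nonneg (hA : IsNonnegSelfAdjoint A) :
    0 ≤ invOneAdd A := by
  rw [ContinuousLinearMap.nonneg_iff_isPositive, ContinuousLinearMap.isPositive_def]
  refine ⟨fun f g => hA.isSymmetric_invOneAdd f g, fun f => ?_⟩
  obtain ⟨u, hu, rfl⟩ := hA.exists_invOneAdd_apply f
  have h := hA.nonneg u
  rw [ContinuousLinearMap.reApplyInnerSelf, hu, inner_add_right, ← hA.inner_apply, map_add]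
  have : 0 ≤ RCLike.re ⟪(u : E), (u : E)⟫_ℂ := inner_self_nonneg
  exact add_nonneg this h

theorem IsNonnegSelfAdjoint.invOneAdd_le_one (hA : IsNonnegSelfAdjoint A) :
    invOneAdd A ≤ 1 := by
  rw [ContinuousLinearMap.le_def, ContinuousLinearMap.isPositive_def]
  refine ⟨fun f g => ?_, fun f => ?_⟩
  · have := hA.isSymmetric_invOneAdd f g
    simp [inner_sub_left, inner_sub_right, this]
  · obtain ⟨u, hu, rfl⟩ := hA.exists_invOneAdd_apply f
    have h := hA.nonneg u
    rw [ContinuousLinearMap.reApplyInnerSelf, sub_apply, hu,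
      one_apply_eq_self, add_sub_cancel_left, inner_add_right, map_add]
    have : 0 ≤ RCLike.re ⟪A u, A u⟫_ℂ := inner_self_nonneg
    exact add_nonneg h this

theorem expNeg_zero : expNeg A 0 = 1 := if_pos rfl

theorem expNeg_of_ne_zero {t : ℝ} (ht : t ≠ 0) : expNeg A t = cfc (expFun t) (invOneAdd A) :=
  if_neg ht

theorem IsNonnegSelfAdjoint.isStep (hA : IsNonnegSelfAdjoint A) {t : ℝ} (ht : 0 < t) :
    IsStep t (invOneAdd A) (expNeg A t) := by
  rw [expNeg_of_ne_zero ht.ne']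
  exact isStep_cfc hA.invOneAdd_nonneg hA.invOneAdd_le_one ht

theorem IsNonnegSelfAdjoint.expNeg_add (hA : IsNonnegSelfAdjoint A) {s t : ℝ} (hs : 0 ≤ s)
    (ht : 0 ≤ t) : expNeg A (s + t) = expNeg A s * expNeg A t := by
  rcases hs.eq_or_lt with rfl | hs
  · simp [expNeg_zero]
  rcases ht.eq_or_lt with rfl | ht
  · simp [expNeg_zero]
  have hsp := spectrum_subset_Icc hA.invOneAdd_nonneg hA.invOneAdd_le_one
  have c1 : ContinuousOn (expFun s) (spectrum ℝ (invOneAdd A)) := (continuousOn_expFun hs).mono hsp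
  have c2 : ContinuousOn (expFun t) (spectrum ℝ (invOneAdd A)) := (continuousOn_expFun ht).mono hsp
  rw [expNeg_of_ne_zero hs.ne', expNeg_of_ne_zero ht.ne', expNeg_of_ne_zero (by positivity),
    ← cfc_mul (expFun s) (expFun t) (invOneAdd A)]
  congr 1
  funext x
  exact expFun_add s t x

theorem IsNonnegSelfAdjoint.expNeg_pow (hA : IsNonnegSelfAdjoint A) {t : ℝ} (ht : 0 ≤ t)
    (n : ℕ) : expNeg A t ^ n = expNeg A (n * t) := by
  induction n with
  | zero => simp [expNeg_zero]
  | succ n ih =>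
    rw [pow_succ, ih, ← hA.expNeg_add (by positivity) ht]
    push_cast; ring_nf

theorem IsNonnegSelfAdjoint.expNeg_nonneg (hA : IsNonnegSelfAdjoint A) {t : ℝ} (ht : 0 ≤ t) :
    0 ≤ expNeg A t := by
  rcases ht.eq_or_lt with rfl | ht
  · rw [expNeg_zero]; exact zero_le_one
  · exact (hA.isStep ht).nonneg

theorem IsNonnegSelfAdjoint.expNeg_le_one (hA : IsNonnegSelfAdjoint A) {t : ℝ} (ht : 0 ≤ t) :
    expNeg A t ≤ 1 := by
  rcases ht.eq_or_lt with rfl | ht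
  · rw [expNeg_zero]
  · exact (hA.isStep ht).le_one

theorem IsNonnegSelfAdjoint.norm_expNeg_le_one (hA : IsNonnegSelfAdjoint A) {t : ℝ}
    (ht : 0 ≤ t) : ‖expNeg A t‖ ≤ 1 :=
  norm_le_one_of_nonneg_of_le_one (hA.expNeg_nonneg ht) (hA.expNeg_le_one ht)

end Semigroup

/-! ### The resolvent estimate -/

section Resolvent

variable {𝓐 : Type*} [CStarAlgebra 𝓐] [PartialOrder 𝓐] [StarOrderedRing 𝓐]

theorem conjugate_nonneg_of_isSelfAdjoint {x p : 𝓐} (hx : IsSelfAdjoint x) (hp : 0 ≤ p) :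
    0 ≤ x * p * x := by
  simpa [hx.star_eq] using star_left_conjugate_nonneg hp x

theorem conjugate_le_of_isSelfAdjoint {x p q : 𝓐} (hx : IsSelfAdjoint x) (h : p ≤ q) :
    x * p * x ≤ x * q * x := by
  simpa [hx.star_eq] using star_left_conjugate_le_conjugate h x

/-- e(1-e) = e(1-e)e + (1-e)e(1-e) is a sum of conjugates of positive elements. -/
theorem mul_one_sub_nonneg {e : 𝓐} (h0 : 0 ≤ e) (h1 : e ≤ 1) : 0 ≤ e * (1 - e) := by
  have he : IsSelfAdjoint e := IsSelfAdjoint.of_nonneg h0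
  have h := add_nonneg (conjugate_nonneg_of_isSelfAdjoint he (sub_nonneg.2 h1))
    (conjugate_nonneg_of_isSelfAdjoint ((IsSelfAdjoint.one 𝓐).sub he) h0)
  have e1 : e * (1 - e) * e + (1 - e) * e * (1 - e) = e * (1 - e) := by noncomm_ring
  rwa [e1] at h

theorem mul_self_le_self {e : 𝓐} (h0 : 0 ≤ e) (h1 : e ≤ 1) : e * e ≤ e := by
  have h := mul_one_sub_nonneg h0 h1
  rw [mul_sub, mul_one] at h
  exact sub_nonneg.1 h

theorem conjugate_le_one {e a : 𝓐} (he0 : 0 ≤ e) (ha1 : a ≤ 1) :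
    e * a * e ≤ e * e := by
  simpa using conjugate_le_of_isSelfAdjoint (IsSelfAdjoint.of_nonneg he0) ha1

/-- The element s is K^{-1/2}, from the functional calculus; the spectrum of K lies in [1,∞). -/
theorem exists_inv_sqrt {K : 𝓐} (hK : 1 ≤ K) :
    ∃ s : 𝓐, IsSelfAdjoint s ∧ s * s * K = 1 ∧ K * (s * s) = 1 ∧ s * K * s = 1 := by
  have hK0 : 0 ≤ K := zero_le_one.trans hK
  have hKs : IsSelfAdjoint K := IsSelfAdjoint.of_nonneg hK0
  have hs : ∀ x ∈ spectrum ℝ K, 1 ≤ x := by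
    have : algebraMap ℝ 𝓐 1 ≤ K := by simpa using hK
    exact (algebraMap_le_iff_le_spectrum (ha := hKs)).1 this
  have hc : ContinuousOn (fun x : ℝ => (Real.sqrt x)⁻¹) (spectrum ℝ K) := by
    refine ContinuousOn.inv₀ (by fun_prop) fun x hx => ?_
    have := hs x hx
    positivity
  have hx : ∀ x ∈ spectrum ℝ K, (Real.sqrt x)⁻¹ * (Real.sqrt x)⁻¹ * x = 1 := fun x hx => by
    have h1 := hs x hx
    rw [← mul_inv, Real.mul_self_sqrt (by linarith), inv_mul_cancel₀ (by linarith)]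
  have e1 : cfc (fun x : ℝ => (Real.sqrt x)⁻¹) K * cfc (fun x : ℝ => (Real.sqrt x)⁻¹) K * K = 1 := by
    calc _ = cfc (fun x : ℝ => (Real.sqrt x)⁻¹ * (Real.sqrt x)⁻¹ * x) K := by
          rw [cfc_mul (fun x : ℝ => (Real.sqrt x)⁻¹ * (Real.sqrt x)⁻¹) (fun x => x) K,
            cfc_mul (fun x : ℝ => (Real.sqrt x)⁻¹) (fun x => (Real.sqrt x)⁻¹) K, cfc_id' ℝ K]
      _ = 1 := by rw [cfc_congr (g := fun _ => 1) (fun x h => hx x h), cfc_const_one ℝ K]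
  have hcm : Commute (cfc (fun x : ℝ => (Real.sqrt x)⁻¹) K) K := by
    have := cfc_commute_cfc (fun x : ℝ => (Real.sqrt x)⁻¹) (fun x => x) K
    rwa [cfc_id' ℝ K] at this
  refine ⟨_, cfc_predicate _ _, e1, ?_, ?_⟩
  · rw [← mul_assoc, ← hcm.eq, mul_assoc, ← hcm.eq, ← mul_assoc, e1]
  · rw [mul_assoc, ← hcm.eq, ← mul_assoc, e1]

/-- Conjugation by s = K^{-1/2} turns the order bound into (sx)(sx)* ≤ β. An element whose square is
at most a multiple of tK thus becomes O(√t) after multiplication by s. -/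
theorem norm_mul_le_sqrt {s K x : 𝓐} (hs : IsSelfAdjoint s) (hsK : s * K * s = 1) {β : ℝ}
    (hx : x * star x ≤ β • K) : ‖s * x‖ ≤ Real.sqrt β := by
  rcases subsingleton_or_nontrivial 𝓐 with h' | h'
  · rw [Subsingleton.elim (s * x) 0, norm_zero]; positivity
  refine Real.le_sqrt_of_sq_le ?_
  rw [sq, ← CStarRing.norm_self_mul_star, star_mul, hs.star_eq]
  have h1 : s * x * (star x * s) ≤ β • (1 : 𝓐) := by
    have := conjugate_le_of_isSelfAdjoint hs hx
    rw [mul_smul_comm, smul_mul_assoc, hsK] at this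
    simpa only [mul_assoc] using this
  have h0 : 0 ≤ s * x * (star x * s) := by
    have := mul_star_self_nonneg (s * x)
    rwa [star_mul, hs.star_eq] at this
  rcases le_or_gt 0 β with hβ | hβ
  · rw [CStarAlgebra.norm_le_iff_le_algebraMap _ hβ h0]
    rwa [Algebra.algebraMap_eq_smul_one]
  · exfalso
    have h2 : (0 : 𝓐) ≤ (-β) • (1 : 𝓐) := smul_nonneg (by linarith) zero_le_one
    have h3 : β • (1 : 𝓐) = 0 := le_antisymm (by rwa [neg_smul, neg_nonneg] at h2) (h0.trans h1)
    rcases smul_eq_zero.1 h3 with h | h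
    · linarith
    · exact one_ne_zero h

variable {XA XB R GA GB a e r : 𝓐} {t M : ℝ}

/-- The resolvent estimate: `(1 + S)⁻¹ - (1 + H)⁻¹ = O(t)` for `S = t⁻¹ (1 - e a e)`, where
`R = (1 + H)⁻¹`, `GA = (1 + A) R`, `GB = (1 + B) R`, `a = e^{-tA}` and `e = e^{-tB/2}`. -/
theorem norm_resolvent_sub_le (ht : 0 < t) (hA : IsStep t XA a) (hB : IsStep t XB (e * e))
    (he0 : 0 ≤ e) (he1 : e ≤ 1) (heX : ‖(1 - e) * XB‖ ≤ t) (hR : IsSelfAdjoint R)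
    (hXA : XA * GA = R) (hXB : XB * GB = R) (hG : GA + GB = 1 + R)
    (hMA : ‖GA‖ ≤ M) (hMB : ‖GB‖ ≤ M)
    (hr : r * (1 + t⁻¹ • (1 - e * a * e)) = 1) (hr' : (1 + t⁻¹ • (1 - e * a * e)) * r = 1) :
    ‖r - R‖ ≤ 41 * M ^ 2 * t := by
  have hM : 0 ≤ M := (norm_nonneg _).trans hMA
  have hes : IsSelfAdjoint e := IsSelfAdjoint.of_nonneg he0
  have has : IsSelfAdjoint a := IsSelfAdjoint.of_nonneg hA.nonneg
  have hes' : IsSelfAdjoint (1 - e) := (IsSelfAdjoint.one 𝓐).sub hes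
  have has' : IsSelfAdjoint (1 - a) := (IsSelfAdjoint.one 𝓐).sub has
  have hee1 : e * e ≤ 1 := (mul_self_le_self he0 he1).trans he1
  have hF := conjugate_le_one he0 hA.le_one
  obtain ⟨K, hK⟩ : ∃ K, K = 1 + t⁻¹ • (1 - e * a * e) := ⟨_, rfl⟩
  rw [← hK] at hr hr'
  have htK : t • K = t • (1 : 𝓐) + (1 - e * a * e) := by
    rw [hK, smul_add, smul_smul, mul_inv_cancel₀ ht.ne', one_smul]
  have hK1 : 1 ≤ K := by
    rw [hK, le_add_iff_nonneg_right]
    exact smul_nonneg (by positivity) (sub_nonneg.2 (hF.trans hee1))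
  have hKs : IsSelfAdjoint K := IsSelfAdjoint.of_nonneg (zero_le_one.trans hK1)
  obtain ⟨s, hs, hs1, hs2, hs3⟩ := exists_inv_sqrt hK1
  have hrs : r = s * s := by
    calc r = s * s * K * r := by rw [hs1, one_mul]
      _ = s * s := by rw [mul_assoc, hr', mul_one]
  have hrSA : IsSelfAdjoint r := by
    rw [hrs, IsSelfAdjoint, star_mul, hs.star_eq]
  -- the operators that are bounded by `K`
  have k1 : 1 - e * e ≤ t • K := by
    rw [htK]
    calc 1 - e * e ≤ 1 - e * a * e := sub_le_sub_left hF 1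
      _ ≤ _ := le_add_of_nonneg_left (smul_nonneg ht.le zero_le_one)
  have k2' : (1 - e) * (1 - e) ≤ 1 - e * e := by
    rw [← sub_nonneg]
    have h := mul_one_sub_nonneg he0 he1
    have e1 : 1 - e * e - (1 - e) * (1 - e) = e * (1 - e) + e * (1 - e) := by noncomm_ring
    rw [e1]; exact add_nonneg h h
  have k2 : (1 - e) * (1 - e) ≤ t • K := k2'.trans k1
  -- As 1 = e + (1-e), the parallelogram inequality gives 1 - a ≤ 2e(1-a)e + 2(1-e)(1-a)(1-e).
  -- Together with (1-e)² ≤ 1 - e² this is at most 2(1 - eae).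
  have k3 : 1 - a ≤ (2 * t) • K := by
    have h1 : 0 ≤ (e - (1 - e)) * (1 - a) * (e - (1 - e)) :=
      conjugate_nonneg_of_isSelfAdjoint (hes.sub hes') (sub_nonneg.2 hA.le_one)
    have h2 : 0 ≤ (1 - e) * a * (1 - e) := conjugate_nonneg_of_isSelfAdjoint hes' hA.nonneg
    have h3 : (0 : 𝓐) ≤ t • (1 : 𝓐) := smul_nonneg ht.le zero_le_one
    have h4 := sub_nonneg.2 k2'
    rw [mul_smul, htK, two_smul, ← sub_nonneg]
    have e1 : t • (1 : 𝓐) + (1 - e * a * e) + (t • (1 : 𝓐) + (1 - e * a * e)) - (1 - a) =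
        (e - (1 - e)) * (1 - a) * (e - (1 - e)) + ((1 - e) * a * (1 - e) + (1 - e) * a * (1 - e)) +
        (t • (1 : 𝓐) + t • (1 : 𝓐)) +
        ((1 - e * e - (1 - e) * (1 - e)) + (1 - e * e - (1 - e) * (1 - e))) := by
      noncomm_ring
    rw [e1]
    positivity
  have k4 : (1 - a) * (1 - a) ≤ (2 * t) • K :=
    (mul_self_le_self (sub_nonneg.2 hA.le_one) (sub_le_self 1 hA.nonneg)).trans k3
  obtain ⟨hA', hhA⟩ : ∃ h, h = stepErr t XA a := ⟨_, rfl⟩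
  obtain ⟨hB', hhB⟩ : ∃ h, h = stepErr t XB (e * e) := ⟨_, rfl⟩
  have hAs := hA.isSelfAdjoint_stepErr
  have hBs := hB.isSelfAdjoint_stepErr
  have hA2 := hA.stepErr_mul_self_le
  have hB2 := hB.stepErr_mul_self_le
  have hA3 := hA.norm_mul_stepErr_le
  have hB3 := hB.norm_mul_stepErr_le
  rw [← hhA] at hAs hA2 hA3
  rw [← hhB] at hBs hB2 hB3
  have n1 : ‖s * hA'‖ ≤ Real.sqrt (2 * t) :=
    norm_mul_le_sqrt hs hs3 (by rw [hAs.star_eq]; exact hA2.trans k3)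
  have n2 : ‖s * hB'‖ ≤ Real.sqrt t :=
    norm_mul_le_sqrt hs hs3 (by rw [hBs.star_eq]; exact hB2.trans k1)
  have n3 : ‖s * (1 - e)‖ ≤ Real.sqrt t :=
    norm_mul_le_sqrt hs hs3 (by rw [hes'.star_eq]; exact k2)
  have n4 : ‖s * (1 - a)‖ ≤ Real.sqrt (2 * t) :=
    norm_mul_le_sqrt hs hs3 (by rw [has'.star_eq]; exact k4)
  have hsq : Real.sqrt (2 * t) ≤ 3 / 2 * Real.sqrt t := by
    rw [Real.sqrt_mul zero_le_two]
    gcongr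
    rw [Real.sqrt_le_left (by norm_num)]
    norm_num
  replace n1 := n1.trans hsq
  replace n4 := n4.trans hsq
  -- the small operators on the range of `R`
  have m1 : ‖(1 - e) * R‖ ≤ t * M := by
    rw [← hXB, ← mul_assoc]
    exact (norm_mul_le _ _).trans (by gcongr)
  have m2 : ‖(1 - a) * R‖ ≤ t * M := by
    rw [← hXA, ← mul_assoc]
    exact (norm_mul_le _ _).trans (by gcongr; exact hA.norm_one_sub_mul_le)
  have m1' : ‖R * (1 - e)‖ ≤ t * M := by
    rw [← norm_star, star_mul, hR.star_eq, hes'.star_eq]; exact m1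
  have m2' : ‖R * (1 - a)‖ ≤ t * M := by
    rw [← norm_star, star_mul, hR.star_eq, has'.star_eq]; exact m2
  have m3 : ‖1 - a‖ ≤ 1 := norm_le_one_of_nonneg_of_le_one (sub_nonneg.2 hA.le_one)
    (sub_le_self 1 hA.nonneg)
  have hti : ‖t⁻¹‖ = t⁻¹ := Real.norm_of_nonneg (by positivity)
  obtain ⟨Y, hY⟩ : ∃ Y, Y = 1 - R - t⁻¹ • ((1 - e * a * e) * R) := ⟨_, rfl⟩
  -- Y is (H - t⁻¹(1 - eae))(1+H)⁻¹. Expanding 1 - eae in 1 - e and 1 - a separates the errors of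
  -- the two single steps from three mixed terms.
  have hY' : Y = hA' * GA + hB' * GB + t⁻¹ • ((1 - e) * ((1 - a) * R)) +
      t⁻¹ • ((1 - a) * ((1 - e) * R)) - t⁻¹ • ((1 - e) * (1 - a) * ((1 - e) * R)) := by
    have e1 : hA' * GA = GA - R - t⁻¹ • ((1 - a) * R) := by
      rw [hhA, stepErr, sub_mul, sub_mul, one_mul, hXA, smul_mul_assoc, mul_assoc, hXA]
    have e2 : hB' * GB = GB - R - t⁻¹ • ((1 - e * e) * R) := by
      rw [hhB, stepErr, sub_mul, sub_mul, one_mul, hXB, smul_mul_assoc, mul_assoc, hXB]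
    have e3 : (1 : 𝓐) = GA + GB - R := by rw [hG, add_sub_cancel_right]
    have e4 : (1 - e * a * e) * R = (1 - a) * R + (1 - e * e) * R - (1 - e) * ((1 - a) * R) -
        (1 - a) * ((1 - e) * R) + (1 - e) * (1 - a) * ((1 - e) * R) := by noncomm_ring
    have e5 : Y = GA + GB - R - R - t⁻¹ • ((1 - e * a * e) * R) := by rw [← e3, hY]
    rw [e5, e1, e2, e4, smul_add, smul_sub, smul_sub, smul_add]
    abel
  have hD : r - R = r * Y := by
    have e1 : K * R = R + t⁻¹ • ((1 - e * a * e) * R) := by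
      rw [hK, add_mul, one_mul, smul_mul_assoc]
    have e2 : Y = 1 - K * R := by rw [hY, e1]; abel
    rw [e2, mul_sub, mul_one, ← mul_assoc, hr, one_mul]
  have hDs : r - R = star Y * r := by
    have := congrArg star hD
    rwa [star_mul, star_sub, hrSA.star_eq, hR.star_eq] at this
  -- The resolvent identity r - R = rY is iterated once with its adjoint r - R = Y*r. In RY the
  -- extra R supplies the missing smoothing, so this term is O(t) directly. In Y*rY = (sY)*(sY) it
  -- is enough that each factor is O(√t).
  have hD2 : r - R = R * Y + star (s * Y) * (s * Y) := by
    calc r - R = R * Y + (r - R) * Y := by rw [sub_mul, add_sub_cancel]; exact hD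
      _ = R * Y + star Y * (s * s) * Y := by rw [hDs, hrs]
      _ = _ := by rw [star_mul, hs.star_eq]; simp only [mul_assoc]
  have hsY : ‖s * Y‖ ≤ 6 * Real.sqrt t * M := by
    have e1 : s * Y = s * hA' * GA + s * hB' * GB + t⁻¹ • (s * (1 - e) * ((1 - a) * R)) +
      t⁻¹ • (s * (1 - a) * ((1 - e) * R)) - t⁻¹ • (s * (1 - e) * (1 - a) * ((1 - e) * R)) := by
      rw [hY', mul_sub s, mul_add s, mul_add s, mul_add s]
      simp only [mul_smul_comm, mul_assoc]
    have h1 : ‖s * hA' * GA‖ ≤ 3 / 2 * Real.sqrt t * M := (norm_mul_le _ _).trans (by gcongr)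
    have h2 : ‖s * hB' * GB‖ ≤ Real.sqrt t * M := (norm_mul_le _ _).trans (by gcongr)
    have h3 : ‖t⁻¹ • (s * (1 - e) * ((1 - a) * R))‖ ≤ Real.sqrt t * M := by
      rw [norm_smul, hti]
      calc _ ≤ t⁻¹ * (Real.sqrt t * (t * M)) := by
            gcongr; exact (norm_mul_le _ _).trans (by gcongr)
        _ = _ := by field_simp
    have h4 : ‖t⁻¹ • (s * (1 - a) * ((1 - e) * R))‖ ≤ 3 / 2 * Real.sqrt t * M := by
      rw [norm_smul, hti]
      calc _ ≤ t⁻¹ * (3 / 2 * Real.sqrt t * (t * M)) := by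
            gcongr; exact (norm_mul_le _ _).trans (by gcongr)
        _ = _ := by field_simp
    have h5 : ‖t⁻¹ • (s * (1 - e) * (1 - a) * ((1 - e) * R))‖ ≤ Real.sqrt t * M := by
      rw [norm_smul, hti]
      calc _ ≤ t⁻¹ * (Real.sqrt t * 1 * (t * M)) := by
            gcongr
            refine (norm_mul_le _ _).trans ?_
            gcongr
            exact (norm_mul_le _ _).trans (by gcongr)
        _ = _ := by field_simp
    rw [e1]
    refine (norm_sub_le _ _).trans ?_
    refine (add_le_add ((norm_add_le _ _).trans (add_le_add ((norm_add_le _ _).trans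
      (add_le_add ((norm_add_le _ _).trans (add_le_add h1 h2)) h3)) h4)) h5).trans ?_
    linarith
  have hRY : ‖R * Y‖ ≤ 5 * M ^ 2 * t := by
    have hRA : R = star GA * XA := by rw [← hR.star_eq, ← hXA, star_mul, hA.isSelfAdjoint.star_eq]
    have hRB : R = star GB * XB := by rw [← hR.star_eq, ← hXB, star_mul, hB.isSelfAdjoint.star_eq]
    have e1 : R * Y = star GA * (XA * hA') * GA + star GB * (XB * hB') * GB +
        t⁻¹ • (R * (1 - e) * ((1 - a) * R)) +
        t⁻¹ • (R * (1 - a) * ((1 - e) * R)) - t⁻¹ • (R * (1 - e) * (1 - a) * ((1 - e) * R)) := by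
      have i1 : star GA * (XA * hA') * GA = R * hA' * GA := by rw [← mul_assoc, ← hRA]
      have i2 : star GB * (XB * hB') * GB = R * hB' * GB := by rw [← mul_assoc, ← hRB]
      rw [i1, i2, hY', mul_sub R, mul_add R, mul_add R, mul_add R]
      simp only [mul_smul_comm, mul_assoc]
    have h1 : ‖star GA * (XA * hA') * GA‖ ≤ M * t * M := by
      refine (norm_mul_le _ _).trans ?_
      gcongr
      refine (norm_mul_le _ _).trans ?_
      rw [norm_star]
      gcongr
    have h2 : ‖star GB * (XB * hB') * GB‖ ≤ M * t * M := by
      refine (norm_mul_le _ _).trans ?_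
      gcongr
      refine (norm_mul_le _ _).trans ?_
      rw [norm_star]
      gcongr
    have h3 : ‖t⁻¹ • (R * (1 - e) * ((1 - a) * R))‖ ≤ M * t * M := by
      rw [norm_smul, hti]
      calc _ ≤ t⁻¹ * ((t * M) * (t * M)) := by
            gcongr; exact (norm_mul_le _ _).trans (by gcongr)
        _ = _ := by field_simp
    have h4 : ‖t⁻¹ • (R * (1 - a) * ((1 - e) * R))‖ ≤ M * t * M := by
      rw [norm_smul, hti]
      calc _ ≤ t⁻¹ * ((t * M) * (t * M)) := by
            gcongr; exact (norm_mul_le _ _).trans (by gcongr)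
        _ = _ := by field_simp
    have h5 : ‖t⁻¹ • (R * (1 - e) * (1 - a) * ((1 - e) * R))‖ ≤ M * t * M := by
      rw [norm_smul, hti]
      calc _ ≤ t⁻¹ * ((t * M) * 1 * (t * M)) := by
            gcongr
            refine (norm_mul_le _ _).trans ?_
            gcongr
            exact (norm_mul_le _ _).trans (by gcongr)
        _ = _ := by field_simp
    rw [e1]
    refine (norm_sub_le _ _).trans ?_
    refine (add_le_add ((norm_add_le _ _).trans (add_le_add ((norm_add_le _ _).trans
      (add_le_add ((norm_add_le _ _).trans (add_le_add h1 h2)) h3)) h4)) h5).trans ?_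
    linarith
  rw [hD2]
  refine (norm_add_le _ _).trans ?_
  calc ‖R * Y‖ + ‖star (s * Y) * (s * Y)‖ ≤ 5 * M ^ 2 * t +
        (6 * Real.sqrt t * M) * (6 * Real.sqrt t * M) := by
        refine add_le_add hRY ((norm_mul_le _ _).trans ?_)
        rw [norm_star]
        gcongr
    _ = 5 * M ^ 2 * t + 36 * M ^ 2 * (Real.sqrt t * Real.sqrt t) := by ring
    _ = 41 * M ^ 2 * t := by rw [Real.mul_self_sqrt ht.le]; ring

end Resolvent

/-! ### From resolvents to powers -/

section Comparison

variable {𝓐 : Type*} [CStarAlgebra 𝓐]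

/-- The resolvent identity with the inverses cleared. It has the shape needed for the comparison of
powers, except that 1 + t⁻¹(1-F) stands in place of 1 - F, and likewise for G. -/
theorem sub_eq_mul_resolvent_sub_mul {F G rF rG : 𝓐} {t : ℝ} (ht : 0 < t)
    (hF : (1 + t⁻¹ • (1 - F)) * rF = 1) (hG : rG * (1 + t⁻¹ • (1 - G)) = 1) :
    F - G = t • ((1 + t⁻¹ • (1 - F)) * (rF - rG) * (1 + t⁻¹ • (1 - G))) := by
  have e : (1 + t⁻¹ • (1 - F)) * (rF - rG) * (1 + t⁻¹ • (1 - G)) = t⁻¹ • (F - G) := by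
    rw [mul_sub, hF, sub_mul, mul_assoc, hG, one_mul, mul_one, add_sub_add_left_eq_sub,
      ← smul_sub]
    congr 1; abel
  rw [e, smul_smul, mul_inv_cancel₀ ht.ne', one_smul]

theorem exists_one_sub_inv {r : 𝓐} {ρ : ℝ} (hr : ‖r‖ ≤ ρ) (hρ : ρ < 1) :
    ∃ V : 𝓐, (1 - r) * V = 1 ∧ V * (1 - r) = 1 ∧ ‖V‖ ≤ (1 - ρ)⁻¹ := by
  have h1 : ‖r‖ < 1 := hr.trans_lt hρ
  have e1 := mul_neg_geom_series r h1
  have e2 := geom_series_mul_neg r h1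
  refine ⟨_, e1, e2, ?_⟩
  generalize (∑' i : ℕ, r ^ i) = V at e1 e2
  rcases subsingleton_or_nontrivial 𝓐 with h | h
  · rw [Subsingleton.elim V 0, norm_zero]
    exact inv_nonneg.2 (by linarith)
  have h2 : V = 1 + r * V := by rw [← e1]; noncomm_ring
  have h3 : ‖V‖ ≤ 1 + ρ * ‖V‖ := by
    calc ‖V‖ = ‖1 + r * V‖ := by rw [← h2]
      _ ≤ ‖(1 : 𝓐)‖ + ‖r‖ * ‖V‖ := (norm_add_le _ _).trans (by gcongr; exact norm_mul_le _ _)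
      _ ≤ 1 + ρ * ‖V‖ := by rw [norm_one]; gcongr
  rw [← one_div, le_div_iff₀ (by linarith)]
  linarith

theorem mul_mul_self_pow_succ (a e : 𝓐) (m : ℕ) :
    (a * (e * e)) ^ (m + 1) = a * e * (e * a * e) ^ m * e := by
  induction m with
  | zero => simp [mul_assoc]
  | succ m ih => rw [pow_succ, ih, pow_succ (e * a * e)]; simp only [mul_assoc]

variable [PartialOrder 𝓐] [StarOrderedRing 𝓐] {F G rF rG : 𝓐} {t c ρ κ : ℝ}

/-- Since 1 - (1+t)⁻¹F = (t/(1+t))(1 + t⁻¹(1-F)), the comparison of powers applies to the rescaled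
contractions (1+t)⁻¹F and (1+t)⁻¹G. Undoing the scaling costs (1+t)^n ≤ e^{nt}. -/
theorem norm_pow_sub_pow_le_exp (ht : 0 < t) (hF0 : 0 ≤ F) (hF1 : F ≤ 1) (hG0 : 0 ≤ G)
    (hG1 : G ≤ 1) (hF : (1 + t⁻¹ • (1 - F)) * rF = 1) (hG : rG * (1 + t⁻¹ • (1 - G)) = 1)
    (hD : ‖rF - rG‖ ≤ c * t) {n : ℕ} (hn : 1 ≤ n) :
    ‖F ^ n - G ^ n‖ ≤ Real.exp (n * t) * (40 * ((1 + t) * c) / n) := by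
  have h1t : (0 : ℝ) < 1 + t := by linarith
  have e1 : ∀ T : 𝓐, 1 - (1 + t)⁻¹ • T = ((1 + t)⁻¹ * t) • (1 + t⁻¹ • (1 - T)) := fun T => by
    have : ((1 + t)⁻¹ * t) • (1 + t⁻¹ • (1 - T)) = (((1 + t)⁻¹ * t) + ((1 + t)⁻¹ * t) * t⁻¹) •
        (1 : 𝓐) - (((1 + t)⁻¹ * t) * t⁻¹) • T := by
      rw [smul_add, smul_smul, smul_sub, add_smul]; abel
    rw [this, show (1 + t)⁻¹ * t + (1 + t)⁻¹ * t * t⁻¹ = 1 by field_simp; ring,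
      show (1 + t)⁻¹ * t * t⁻¹ = (1 + t)⁻¹ by field_simp, one_smul]
  have e2 : (1 + t)⁻¹ • F - (1 + t)⁻¹ • G = (1 - (1 + t)⁻¹ • F) * (((1 + t) * t⁻¹) • (rF - rG)) *
      (1 - (1 + t)⁻¹ • G) := by
    rw [← smul_sub, sub_eq_mul_resolvent_sub_mul ht hF hG, e1, e1]
    simp only [smul_mul_assoc, mul_smul_comm, smul_smul]
    congr 1
    field_simp
  have hb : ∀ T : 𝓐, 0 ≤ T → T ≤ 1 → 0 ≤ (1 + t)⁻¹ • T ∧ (1 + t)⁻¹ • T ≤ 1 := fun T h0 h1 => by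
    refine ⟨smul_nonneg (by positivity) h0, ?_⟩
    have : 0 ≤ 1 + t⁻¹ • (1 - T) :=
      add_nonneg zero_le_one (smul_nonneg (by positivity) (sub_nonneg.2 h1))
    rw [← sub_nonneg, e1]
    exact smul_nonneg (by positivity) this
  have h := norm_pow_sub_pow_le_div (hb F hF0 hF1).1 (hb F hF0 hF1).2 (hb G hG0 hG1).1
    (hb G hG0 hG1).2 e2 (c := (1 + t) * c) (by
      rw [norm_smul, Real.norm_of_nonneg (by positivity)]
      calc _ ≤ (1 + t) * t⁻¹ * (c * t) := by gcongr
        _ = _ := by field_simp) hn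
  have e3 : F ^ n - G ^ n = (1 + t) ^ n • (((1 + t)⁻¹ • F) ^ n - ((1 + t)⁻¹ • G) ^ n) := by
    rw [smul_pow, smul_pow, ← smul_sub, smul_smul, ← mul_pow, mul_inv_cancel₀ h1t.ne', one_pow,
      one_smul]
  rw [e3, norm_smul, Real.norm_of_nonneg (by positivity)]
  have h2 : (1 + t) ^ n ≤ Real.exp (n * t) := by
    rw [Real.exp_nat_mul]
    gcongr
    linarith [Real.add_one_le_exp t]
  exact mul_le_mul h2 h (norm_nonneg _) (Real.exp_pos _).le

/-- The identity t⁻¹(1-F) = (1 + t⁻¹(1-F))(1 - rF) and the Neumann series for 1 - rF replace the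
factor 1 + t⁻¹(1-F) by t⁻¹(1-F) times a bounded element. No rescaling is needed, and the bound does
not grow with nt. -/
theorem norm_pow_sub_pow_le_of_norm_resolvent_le (ht : 0 < t) (hF0 : 0 ≤ F) (hF1 : F ≤ 1)
    (hG0 : 0 ≤ G) (hG1 : G ≤ 1) (hF : (1 + t⁻¹ • (1 - F)) * rF = 1)
    (hG : rG * (1 + t⁻¹ • (1 - G)) = 1) (hD : ‖rF - rG‖ ≤ c * t) (hρF : ‖rF‖ ≤ ρ)
    (hρG : ‖rG‖ ≤ ρ) (hρ : ρ < 1) {n : ℕ} (hn : 1 ≤ n) :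
    ‖F ^ n - G ^ n‖ ≤ 40 * ((1 - ρ)⁻¹ * c * (1 - ρ)⁻¹) / n := by
  obtain ⟨V, hV1, -, hVn⟩ := exists_one_sub_inv hρF hρ
  obtain ⟨W, -, hW1, hWn⟩ := exists_one_sub_inv hρG hρ
  have hρ' : 0 ≤ (1 - ρ)⁻¹ := inv_nonneg.2 (by linarith)
  have hct : 0 ≤ c * t := (norm_nonneg _).trans hD
  have e1 : 1 + t⁻¹ • (1 - F) = t⁻¹ • ((1 - F) * V) := by
    calc 1 + t⁻¹ • (1 - F) = (1 + t⁻¹ • (1 - F)) * ((1 - rF) * V) := by rw [hV1, mul_one]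
      _ = _ := by rw [← mul_assoc, mul_sub, hF, mul_one, add_sub_cancel_left, smul_mul_assoc]
  have e2 : 1 + t⁻¹ • (1 - G) = t⁻¹ • (W * (1 - G)) := by
    calc 1 + t⁻¹ • (1 - G) = (W * (1 - rG)) * (1 + t⁻¹ • (1 - G)) := by rw [hW1, one_mul]
      _ = _ := by rw [mul_assoc, sub_mul, hG, one_mul, add_sub_cancel_left, mul_smul_comm]
  refine norm_pow_sub_pow_le_div (Δ := t⁻¹ • (V * (rF - rG) * W)) hF0 hF1 hG0 hG1 ?_ ?_ hn
  · rw [sub_eq_mul_resolvent_sub_mul ht hF hG, e1, e2]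
    simp only [smul_mul_assoc, mul_smul_comm, smul_smul, mul_assoc]
    congr 1
    field_simp
  · rw [norm_smul, Real.norm_of_nonneg (by positivity)]
    calc _ ≤ t⁻¹ * ((1 - ρ)⁻¹ * (c * t) * (1 - ρ)⁻¹) := by
          gcongr
          refine (norm_mul_le _ _).trans ?_
          gcongr
          exact (norm_mul_le _ _).trans (by gcongr)
      _ = _ := by field_simp

/-- An analytic smoothing bound. It turns an O(t) bound for x·rG into an O(1/(m+1)) bound for xG^m,
as needed for the nonsymmetric product. -/
theorem norm_generator_mul_pow_le (ht : 0 < t) (hG0 : 0 ≤ G) (hG1 : G ≤ 1) {m : ℕ} {L : ℝ}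
    (hL : (m + 1) * t ≤ L) :
    ‖(1 + t⁻¹ • (1 - G)) * G ^ m‖ ≤ (1 + L) * t⁻¹ / (m + 1) := by
  have hGn := norm_le_one_of_nonneg_of_le_one hG0 hG1
  have hone : ‖G ^ m‖ ≤ 1 := by
    rcases subsingleton_or_nontrivial 𝓐 with h | h
    · rw [Subsingleton.elim (G ^ m) 0, norm_zero]; exact zero_le_one
    · exact (norm_pow_le G m).trans (pow_le_one₀ (norm_nonneg _) hGn)
  have e : (1 + t⁻¹ • (1 - G)) * G ^ m = G ^ m + t⁻¹ • (G ^ m * (1 - G)) := by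
    have : (1 - G) * G ^ m = G ^ m * (1 - G) := by
      rw [sub_mul, mul_sub, one_mul, mul_one, pow_mul_comm']
    rw [add_mul, one_mul, smul_mul_assoc, this]
  rw [e]
  refine (norm_add_le _ _).trans ?_
  rw [norm_smul, Real.norm_of_nonneg (by positivity)]
  calc _ ≤ 1 + t⁻¹ * (1 / (m + 1)) := by
        gcongr; exact norm_pow_mul_one_sub_le hG0 hG1 m
    _ = ((m + 1) * t + 1) * t⁻¹ / (m + 1) := by field_simp
    _ ≤ _ := by
        rw [add_comm (1 : ℝ) L]
        gcongr

theorem norm_generator_mul_pow_le_of_norm_resolvent_le (ht : 0 < t) (hG0 : 0 ≤ G) (hG1 : G ≤ 1)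
    (hG : rG * (1 + t⁻¹ • (1 - G)) = 1) (hρG : ‖rG‖ ≤ ρ) (hρ : ρ < 1) (m : ℕ) :
    ‖(1 + t⁻¹ • (1 - G)) * G ^ m‖ ≤ (1 - ρ)⁻¹ * t⁻¹ / (m + 1) := by
  obtain ⟨W, -, hW1, hWn⟩ := exists_one_sub_inv hρG hρ
  have e : (1 + t⁻¹ • (1 - G)) * G ^ m = t⁻¹ • (W * (G ^ m * (1 - G))) := by
    have h1 : (1 - G) * G ^ m = G ^ m * (1 - G) := by
      rw [sub_mul, mul_sub, one_mul, mul_one, pow_mul_comm']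
    have h2 : 1 + t⁻¹ • (1 - G) = t⁻¹ • (W * (1 - G)) := by
      calc 1 + t⁻¹ • (1 - G) = (W * (1 - rG)) * (1 + t⁻¹ • (1 - G)) := by rw [hW1, one_mul]
        _ = _ := by rw [mul_assoc, sub_mul, hG, one_mul, add_sub_cancel_left, mul_smul_comm]
    rw [h2, smul_mul_assoc, mul_assoc, h1]
  rw [e, norm_smul, Real.norm_of_nonneg (by positivity)]
  calc _ ≤ t⁻¹ * ((1 - ρ)⁻¹ * (1 / (m + 1))) := by
        gcongr
        refine (norm_mul_le _ _).trans ?_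
        exact mul_le_mul hWn (norm_pow_mul_one_sub_le hG0 hG1 m) (norm_nonneg _)
          ((norm_nonneg _).trans hWn)
    _ = _ := by field_simp

/-- From the symmetric product to the nonsymmetric product. -/
theorem norm_nonsymm_pow_sub_pow_le {a e : 𝓐} {b C : ℝ} (ht : 0 < t) (ha : ‖a‖ ≤ 1)
    (he0 : 0 ≤ e) (he1 : e ≤ 1) (hG0 : 0 ≤ G) (hG1 : G ≤ 1)
    (hG : rG * (1 + t⁻¹ • (1 - G)) = 1) (har : ‖(1 - a) * rG‖ ≤ b * t)
    (her : ‖(1 - e) * rG‖ ≤ b * t) (m : ℕ)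
    (hK : ‖(1 + t⁻¹ • (1 - G)) * G ^ m‖ ≤ κ * t⁻¹ / (m + 1))
    (hFG : ‖(e * a * e) ^ m - G ^ m‖ ≤ C / (m + 1)) :
    ‖(a * (e * e)) ^ (m + 1) - G ^ (m + 1)‖ ≤ (C + 3 * (b * κ) + 1) / (m + 1) := by
  have hes : IsSelfAdjoint e := IsSelfAdjoint.of_nonneg he0
  have hGs : IsSelfAdjoint G := IsSelfAdjoint.of_nonneg hG0
  have hes' : IsSelfAdjoint (1 - e) := (IsSelfAdjoint.one 𝓐).sub hes
  have hen := norm_le_one_of_nonneg_of_le_one he0 he1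
  have hbt : 0 ≤ b * t := (norm_nonneg _).trans har
  have h1 : ∀ x : 𝓐, ‖x * rG‖ ≤ b * t → ‖x * G ^ m‖ ≤ b * κ / (m + 1) := fun x hx => by
    have e1 : x * G ^ m = (x * rG) * ((1 + t⁻¹ • (1 - G)) * G ^ m) := by
      rw [mul_assoc, ← mul_assoc rG, hG, one_mul]
    rw [e1]
    calc _ ≤ (b * t) * (κ * t⁻¹ / (m + 1)) := (norm_mul_le _ _).trans (by gcongr)
      _ = _ := by field_simp
  have ha1 := h1 _ har
  have he1 := h1 _ her
  have he2 : ‖G ^ m * (1 - e)‖ ≤ b * κ / (m + 1) := by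
    rw [← norm_star, star_mul, star_pow, hGs.star_eq, hes'.star_eq]; exact he1
  -- The regrouped power is ae(eae)^m e. Successively (eae)^m is replaced by G^m, then a and the two
  -- outer factors e by 1 next to G^m, and finally G^m by G^{m+1}.
  have e1 : (a * (e * e)) ^ (m + 1) - G ^ (m + 1) = a * e * ((e * a * e) ^ m - G ^ m) * e -
      (1 - a) * G ^ m * e - a * ((1 - e) * G ^ m) * e - G ^ m * (1 - e) + G ^ m * (1 - G) := by
    rw [mul_mul_self_pow_succ, pow_succ G m]
    noncomm_ring
  have b1 : ‖a * e * ((e * a * e) ^ m - G ^ m) * e‖ ≤ C / (m + 1) := by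
    calc _ ≤ ‖a‖ * ‖e‖ * ‖(e * a * e) ^ m - G ^ m‖ * ‖e‖ :=
          (norm_mul_le _ _).trans (mul_le_mul_of_nonneg_right ((norm_mul_le _ _).trans
            (mul_le_mul_of_nonneg_right (norm_mul_le _ _) (norm_nonneg _))) (norm_nonneg _))
      _ ≤ 1 * 1 * (C / (m + 1)) * 1 := by
          have := (norm_nonneg _).trans hFG
          gcongr
      _ = _ := by ring
  have b2 : ‖(1 - a) * G ^ m * e‖ ≤ b * κ / (m + 1) := by
    calc _ ≤ (b * κ / (m + 1)) * 1 := (norm_mul_le _ _).trans (mul_le_mul ha1 hen (norm_nonneg _)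
          ((norm_nonneg _).trans ha1))
      _ = _ := mul_one _
  have b3 : ‖a * ((1 - e) * G ^ m) * e‖ ≤ b * κ / (m + 1) := by
    calc _ ≤ ‖a‖ * ‖(1 - e) * G ^ m‖ * ‖e‖ :=
          (norm_mul_le _ _).trans (by gcongr; exact norm_mul_le _ _)
      _ ≤ 1 * (b * κ / (m + 1)) * 1 := by
          have := (norm_nonneg _).trans he1
          gcongr
      _ = _ := by ring
  have b4 := norm_pow_mul_one_sub_le hG0 hG1 m
  rw [e1]
  refine (norm_add_le _ _).trans ((add_le_add ((norm_sub_le _ _).trans (add_le_add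
    ((norm_sub_le _ _).trans (add_le_add ((norm_sub_le _ _).trans (add_le_add b1 b2)) b3)) he2))
    b4).trans (le_of_eq ?_))
  field_simp
  ring

/-- The norm of a positive element belongs to its spectrum, while 1 - F = t(1 + t⁻¹(1-F))(1 - rF) is
a product of invertible elements. -/
theorem norm_lt_one_of_norm_resolvent_lt (ht : 0 < t) (hF0 : 0 ≤ F) (hF1 : F ≤ 1)
    (hF : (1 + t⁻¹ • (1 - F)) * rF = 1) (hF' : rF * (1 + t⁻¹ • (1 - F)) = 1)
    (hr : ‖rF‖ < 1) : ‖F‖ < 1 := by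
  rcases subsingleton_or_nontrivial 𝓐 with h | h
  · rw [Subsingleton.elim F 0, norm_zero]; exact zero_lt_one
  refine lt_of_le_of_ne (norm_le_one_of_nonneg_of_le_one hF0 hF1) fun h1 => ?_
  have hmem := CStarAlgebra.norm_mem_spectrum_of_nonneg hF0
  rw [h1, spectrum.mem_iff] at hmem
  apply hmem
  obtain ⟨V, hV1, hV2, -⟩ := exists_one_sub_inv le_rfl hr
  have u1 : IsUnit (1 - rF) := ⟨⟨_, V, hV1, hV2⟩, rfl⟩
  have u2 : IsUnit (1 + t⁻¹ • (1 - F)) := ⟨⟨_, rF, hF, hF'⟩, rfl⟩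
  have e : t⁻¹ • (1 - F) = (1 + t⁻¹ • (1 - F)) * (1 - rF) := by
    rw [mul_sub, hF, mul_one, add_sub_cancel_left]
  have u3 : IsUnit (t⁻¹ • (1 - F)) := e ▸ u2.mul u1
  rw [map_one]
  have e2 : 1 - F = (algebraMap ℝ 𝓐 t) * (t⁻¹ • (1 - F)) := by
    rw [Algebra.algebraMap_eq_smul_one, smul_mul_assoc, one_mul, smul_smul,
      mul_inv_cancel₀ ht.ne', one_smul]
  rw [e2]
  exact ((isUnit_iff_ne_zero.2 ht.ne').map _).mul u3

end Comparison

/-! ### Error bounds for the product formulas -/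

section ErrorBounds

variable {E : Type*} [NormedAddCommGroup E] [InnerProductSpace ℂ E]

theorem norm_pow_le_div {T : E →L[ℂ] E} {q : ℝ} (hT : ‖T‖ ≤ q) (hq : q < 1) (m : ℕ) :
    ‖T ^ m‖ ≤ (1 - q)⁻¹ / (m + 1) := by
  have hq0 : 0 ≤ q := (norm_nonneg _).trans hT
  have h1 : ‖T ^ m‖ ≤ q ^ m := by
    rcases subsingleton_or_nontrivial E with h | h
    · rw [Subsingleton.elim (T ^ m) 0, norm_zero]; positivity
    · exact (norm_pow_le T m).trans (pow_le_pow_left₀ (norm_nonneg _) hT m)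
  have h2 := pow_mul_one_sub_le hq0 hq.le m
  rw [← le_div_iff₀ (by linarith)] at h2
  refine h1.trans (h2.trans (le_of_eq ?_))
  rw [div_div, inv_eq_one_div, div_div, mul_comm]

variable [CompleteSpace E]

/-- Closed graph theorem: injectivity of X makes the solution g of Xg = Rf unique, hence linear in
f, and this equation describes a closed graph. -/
theorem exists_continuousLinearMap_mul_eq {X R : E →L[ℂ] E} (hX : Function.Injective X)
    (h : ∀ f, ∃ g, X g = R f) : ∃ G : E →L[ℂ] E, X * G = R := by
  choose g hg using h
  let T : E →ₗ[ℂ] E :=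
    { toFun := g
      map_add' := fun x y => hX (by simp [hg])
      map_smul' := fun c x => hX (by simp [hg]) }
  have hT : ∀ f, X (T f) = R f := hg
  have hc : Continuous T := by
    refine T.continuous_of_isClosed_graph ?_
    have : (T.graph : Set (E × E)) = {p | X p.2 = R p.1} := by
      ext p
      simp only [SetLike.mem_coe, LinearMap.mem_graph_iff, Set.mem_ofPred_eq]
      rw [← hT]
      exact ⟨fun h => by rw [h], fun h => hX h⟩
    rw [this]
    exact isClosed_eq (by fun_prop) (by fun_prop)
  exact ⟨⟨T, hc⟩, ContinuousLinearMap.ext hT⟩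

variable {A B : E →ₗ.[ℂ] E}

theorem IsNonnegSelfAdjoint.add (hA : IsNonnegSelfAdjoint A) (hB : IsNonnegSelfAdjoint B)
    (hH : IsSelfAdjoint (A + B)) : IsNonnegSelfAdjoint (A + B) := by
  refine ⟨hH, fun x => ?_⟩
  rw [LinearPMap.add_apply, inner_add_left, Complex.add_re]
  exact add_nonneg (hA.nonneg ⟨x, x.2.1⟩) (hB.nonneg ⟨x, x.2.2⟩)

/-- `GA` and `GB` are (1+A)(1+H)⁻¹ and (1+B)(1+H)⁻¹ with H = A + B. They are everywhere defined
because D[H] lies in both domains. -/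
theorem exists_relative_bounds (hA : IsNonnegSelfAdjoint A) (hB : IsNonnegSelfAdjoint B)
    (hH : IsSelfAdjoint (A + B)) : ∃ GA GB : E →L[ℂ] E,
      invOneAdd A * GA = invOneAdd (A + B) ∧ invOneAdd B * GB = invOneAdd (A + B) ∧
      GA + GB = 1 + invOneAdd (A + B) := by
  have hS := hA.add hB hH
  have key : ∀ f, ∃ (u : E) (h1 : u ∈ A.domain) (h2 : u ∈ B.domain),
      invOneAdd (A + B) f = u ∧ f = u + (A ⟨u, h1⟩ + B ⟨u, h2⟩) := fun f => by
    obtain ⟨u, hu, hf⟩ := hS.exists_invOneAdd_apply f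
    exact ⟨u, u.2.1, u.2.2, hu, by rw [hf, LinearPMap.add_apply]⟩
  obtain ⟨GA, hGA⟩ := exists_continuousLinearMap_mul_eq (R := invOneAdd (A + B))
    hA.invOneAdd_injective fun f => by
      obtain ⟨u, h1, h2, hu, -⟩ := key f
      exact ⟨u + A ⟨u, h1⟩, by rw [hu]; exact hA.invOneAdd_add_apply ⟨u, h1⟩⟩
  obtain ⟨GB, hGB⟩ := exists_continuousLinearMap_mul_eq (R := invOneAdd (A + B))
    hB.invOneAdd_injective fun f => by
      obtain ⟨u, h1, h2, hu, -⟩ := key f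
      exact ⟨u + B ⟨u, h2⟩, by rw [hu]; exact hB.invOneAdd_add_apply ⟨u, h2⟩⟩
  refine ⟨GA, GB, hGA, hGB, ContinuousLinearMap.ext fun f => ?_⟩
  obtain ⟨u, h1, h2, hu, hf⟩ := key f
  have e1 : GA f = u + A ⟨u, h1⟩ := hA.invOneAdd_injective (by
    have := hA.invOneAdd_add_apply ⟨u, h1⟩
    rw [this]
    calc _ = (invOneAdd A * GA) f := rfl
      _ = u := by rw [hGA, hu])
  have e2 : GB f = u + B ⟨u, h2⟩ := hB.invOneAdd_injective (by
    have := hB.invOneAdd_add_apply ⟨u, h2⟩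
    rw [this]
    calc _ = (invOneAdd B * GB) f := rfl
      _ = u := by rw [hGB, hu])
  have e3 : (1 + invOneAdd (A + B)) f = f + u := by
    rw [add_apply, one_apply_eq_self, hu]
  rw [add_apply, e1, e2, e3, hf]
  abel

/-- The symmetric product of one step. -/
noncomputable def symmStep (A B : E →ₗ.[ℂ] E) (t : ℝ) : E →L[ℂ] E :=
  expNeg B (t / 2) * expNeg A t * expNeg B (t / 2)

theorem expNeg_half_mul_self (hB : IsNonnegSelfAdjoint B) {t : ℝ} (ht : 0 ≤ t) :
    expNeg B (t / 2) * expNeg B (t / 2) = expNeg B t := by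
  rw [← hB.expNeg_add (by positivity) (by positivity), add_halves]

theorem symmStep_nonneg (hA : IsNonnegSelfAdjoint A) (hB : IsNonnegSelfAdjoint B) {t : ℝ}
    (ht : 0 ≤ t) : 0 ≤ symmStep A B t :=
  conjugate_nonneg_of_isSelfAdjoint (IsSelfAdjoint.of_nonneg (hB.expNeg_nonneg (by positivity)))
    (hA.expNeg_nonneg ht)

theorem symmStep_le_one (hA : IsNonnegSelfAdjoint A) (hB : IsNonnegSelfAdjoint B) {t : ℝ}
    (ht : 0 ≤ t) : symmStep A B t ≤ 1 :=
  (conjugate_le_one (hB.expNeg_nonneg (by positivity)) (hA.expNeg_le_one ht)).trans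
    (by rw [expNeg_half_mul_self hB ht]; exact hB.expNeg_le_one ht)

/-- The bounded inverses of `1 + t⁻¹ (1 - F)` and `1 + t⁻¹ (1 - G)`, where `F` is the symmetric
product of one step and `G = e^{-t(A + B)}`, approximate `(1 + A + B)⁻¹` to the first order. -/
theorem exists_resolvent_estimates (hA : IsNonnegSelfAdjoint A) (hB : IsNonnegSelfAdjoint B)
    (hH : IsSelfAdjoint (A + B)) : ∃ c : ℝ, 0 < c ∧ ∀ t : ℝ, 0 < t → ∃ rF rG : E →L[ℂ] E,
      (1 + t⁻¹ • (1 - symmStep A B t)) * rF = 1 ∧ rF * (1 + t⁻¹ • (1 - symmStep A B t)) = 1 ∧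
      (1 + t⁻¹ • (1 - expNeg (A + B) t)) * rG = 1 ∧
      rG * (1 + t⁻¹ • (1 - expNeg (A + B) t)) = 1 ∧
      ‖rF - invOneAdd (A + B)‖ ≤ c * t ∧ ‖rG - invOneAdd (A + B)‖ ≤ c * t ∧
      ‖(1 - expNeg A t) * rG‖ ≤ c * t ∧ ‖(1 - expNeg B (t / 2)) * rG‖ ≤ c * t := by
  obtain ⟨GA, GB, hGA, hGB, hG⟩ := exists_relative_bounds hA hB hH
  have hS := hA.add hB hH
  set R := invOneAdd (A + B) with hRdef
  have hR0 : 0 ≤ R := hS.invOneAdd_nonneg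
  have hRn : ‖R‖ ≤ 1 := norm_le_one_of_nonneg_of_le_one hR0 hS.invOneAdd_le_one
  have hone : ‖(1 : E →L[ℂ] E)‖ ≤ 1 := norm_le_one_of_nonneg_of_le_one zero_le_one le_rfl
  obtain ⟨M, hM⟩ : ∃ M, M = max ‖GA‖ ‖GB‖ := ⟨_, rfl⟩
  have hMA : ‖GA‖ ≤ M := hM ▸ le_max_left _ _
  have hMB : ‖GB‖ ≤ M := hM ▸ le_max_right _ _
  have hM0 : 0 ≤ M := (norm_nonneg _).trans hMA
  refine ⟨41 * M ^ 2 + M + 41, by positivity, fun t ht => ?_⟩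
  have hinv : ∀ T : E →L[ℂ] E, T ≤ 1 → ∃ r, (1 + t⁻¹ • (1 - T)) * r = 1 ∧
      r * (1 + t⁻¹ • (1 - T)) = 1 := fun T hT => by
    obtain ⟨s, -, h1, h2, -⟩ := exists_inv_sqrt (K := 1 + t⁻¹ • (1 - T))
      (le_add_of_nonneg_right (smul_nonneg (by positivity) (sub_nonneg.2 hT)))
    exact ⟨s * s, h2, h1⟩
  obtain ⟨rF, hF1, hF2⟩ := hinv _ (symmStep_le_one hA hB ht.le)
  obtain ⟨rG, hG1, hG2⟩ := hinv _ (hS.expNeg_le_one ht.le)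
  have ht2 : 0 < t / 2 := by positivity
  have heX : ‖(1 - expNeg B (t / 2)) * invOneAdd B‖ ≤ t :=
    (hB.isStep ht2).norm_one_sub_mul_le.trans (by linarith)
  have hDF : ‖rF - R‖ ≤ 41 * M ^ 2 * t :=
    norm_resolvent_sub_le ht (hA.isStep ht) (expNeg_half_mul_self hB ht.le ▸ hB.isStep ht)
      (hB.expNeg_nonneg ht2.le) (hB.expNeg_le_one ht2.le) heX (IsSelfAdjoint.of_nonneg hR0)
      hGA hGB hG hMA hMB hF2 hF1
  -- The same estimate with A + B in the role of A and the zero operator in the role of B.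
  have hDG : ‖rG - R‖ ≤ 41 * 1 ^ 2 * t := by
    refine norm_resolvent_sub_le (XA := R) (XB := 1) (GA := 1) (GB := R) (a := expNeg (A + B) t)
      (e := 1) ht (hS.isStep ht) (by rw [mul_one]; exact isStep_one ht) zero_le_one le_rfl
      (by simpa using ht.le) (IsSelfAdjoint.of_nonneg hR0) (mul_one _) (one_mul _) rfl hone hRn ?_ ?_
    · simpa using hG2
    · simpa using hG1
  have hx : ∀ T X Q : E →L[ℂ] E, ‖T‖ ≤ 1 → ‖T * X‖ ≤ t → X * Q = R → ‖Q‖ ≤ M →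
      ‖T * rG‖ ≤ (41 * M ^ 2 + M + 41) * t := fun T X Q hT hTX hXQ hQ => by
    have e : T * rG = T * X * Q + T * (rG - R) := by rw [mul_assoc, hXQ]; noncomm_ring
    rw [e]
    calc _ ≤ t * M + 1 * (41 * 1 ^ 2 * t) := by
          refine (norm_add_le _ _).trans (add_le_add ((norm_mul_le _ _).trans ?_)
            ((norm_mul_le _ _).trans ?_)) <;> gcongr
      _ ≤ _ := by nlinarith [mul_nonneg (sq_nonneg M) ht.le]
  have hsub : ∀ T : E →L[ℂ] E, 0 ≤ T → T ≤ 1 → ‖1 - T‖ ≤ 1 := fun T h0 h1 =>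
    norm_le_one_of_nonneg_of_le_one (sub_nonneg.2 h1) (sub_le_self 1 h0)
  refine ⟨rF, rG, hF1, hF2, hG1, hG2, hDF.trans ?_, hDG.trans ?_,
    hx _ _ _ (hsub _ (hA.expNeg_nonneg ht.le) (hA.expNeg_le_one ht.le))
      (hA.isStep ht).norm_one_sub_mul_le hGA hMA,
    hx _ _ _ (hsub _ (hB.expNeg_nonneg ht2.le) (hB.expNeg_le_one ht2.le)) heX hGB hMB⟩
  · gcongr; linarith
  · gcongr; nlinarith [sq_nonneg M]

theorem symmProduct_eq {n : ℕ} {t τ : ℝ} (hn : 1 ≤ n) (ht : t = n * τ) :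
    symmProduct A B n t = symmStep A B τ ^ n := by
  have hn0 : (n : ℝ) ≠ 0 := by positivity
  rw [symmProduct, symmStep, ht, show n * τ / (2 * n) = τ / 2 by field_simp,
    show n * τ / n = τ by field_simp]

theorem nonsymmProduct_eq {n : ℕ} {t τ : ℝ} (hn : 1 ≤ n) (ht : t = n * τ) :
    nonsymmProduct A B n t = (expNeg A τ * expNeg B τ) ^ n := by
  have hn0 : (n : ℝ) ≠ 0 := by positivity
  rw [nonsymmProduct, ht, show n * τ / n = τ by field_simp]

/-- A bound for all powers of the symmetric product implies the error bounds for both products. -/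
theorem norm_products_sub_le (hA : IsNonnegSelfAdjoint A) (hB : IsNonnegSelfAdjoint B)
    (hH : IsSelfAdjoint (A + B)) {τ b κ C : ℝ} (hτ : 0 < τ) {n : ℕ} (hn : 1 ≤ n)
    {rG : E →L[ℂ] E} (hG : rG * (1 + τ⁻¹ • (1 - expNeg (A + B) τ)) = 1)
    (har : ‖(1 - expNeg A τ) * rG‖ ≤ b * τ) (her : ‖(1 - expNeg B (τ / 2)) * rG‖ ≤ b * τ)
    (hC : 0 ≤ C) (hb : 0 ≤ b) (hκ : 0 ≤ κ)
    (hK : ∀ m : ℕ, m + 1 ≤ n →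
      ‖(1 + τ⁻¹ • (1 - expNeg (A + B) τ)) * expNeg (A + B) τ ^ m‖ ≤ κ * τ⁻¹ / (m + 1))
    (hFG : ∀ m : ℕ, 1 ≤ m → m ≤ n → ‖symmStep A B τ ^ m - expNeg (A + B) τ ^ m‖ ≤ C / m) :
    ‖symmProduct A B n (n * τ) - expNeg (A + B) (n * τ)‖ ≤ (2 * C + 3 * (b * κ) + 1) / n ∧
    ‖nonsymmProduct A B n (n * τ) - expNeg (A + B) (n * τ)‖ ≤
      (2 * C + 3 * (b * κ) + 1) / n := by
  have hS := hA.add hB hH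
  have hτ2 : 0 ≤ τ / 2 := by positivity
  rw [symmProduct_eq hn rfl, nonsymmProduct_eq hn rfl, ← hS.expNeg_pow hτ.le]
  constructor
  · refine (hFG n hn le_rfl).trans ?_
    gcongr
    nlinarith [mul_nonneg hb hκ]
  · obtain ⟨m, rfl⟩ : ∃ m, n = m + 1 := ⟨n - 1, by omega⟩
    rw [← expNeg_half_mul_self hB hτ.le]
    -- Regrouping leaves only m = n - 1 symmetric steps; the doubled constant absorbs C/m ≤
    -- 2C/(m+1).
    have h := norm_nonsymm_pow_sub_pow_le hτ (hA.norm_expNeg_le_one hτ.le)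
      (hB.expNeg_nonneg hτ2) (hB.expNeg_le_one hτ2) (hS.expNeg_nonneg hτ.le)
      (hS.expNeg_le_one hτ.le) hG har her m (hK m le_rfl) (C := 2 * C) ?_
    · push_cast; exact h
    · rcases m.eq_zero_or_pos with rfl | hm
      · simpa using hC
      · refine (hFG m hm (by omega)).trans ?_
        have : (1 : ℝ) ≤ m := by exact_mod_cast hm
        rw [div_le_div_iff₀ (by positivity) (by positivity)]
        nlinarith

theorem symmProduct_zero (n : ℕ) : symmProduct A B n 0 = 1 := by
  simp [symmProduct, expNeg_zero]

theorem nonsymmProduct_zero (n : ℕ) : nonsymmProduct A B n 0 = 1 := by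
  simp [nonsymmProduct, expNeg_zero]

theorem exists_error_bound_on_Icc (hA : IsNonnegSelfAdjoint A) (hB : IsNonnegSelfAdjoint B)
    (hH : IsSelfAdjoint (A + B)) {L : ℝ} (hL : 0 ≤ L) :
    ∃ C : ℝ, ∀ n : ℕ, 1 ≤ n → ∀ t ∈ Set.Icc 0 L,
      ‖symmProduct A B n t - expNeg (A + B) t‖ ≤ C / n ∧
      ‖nonsymmProduct A B n t - expNeg (A + B) t‖ ≤ C / n := by
  have hS := hA.add hB hH
  obtain ⟨c, hc, hr⟩ := exists_resolvent_estimates hA hB hH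
  obtain ⟨C, hCdef⟩ : ∃ C, C = Real.exp L * (40 * ((1 + L) * (2 * c))) := ⟨_, rfl⟩
  have hC : 0 ≤ C := by rw [hCdef]; positivity
  refine ⟨2 * C + 3 * (c * (1 + L)) + 1, fun n hn t ht => ?_⟩
  have hn1 : (1 : ℝ) ≤ n := by exact_mod_cast hn
  rcases ht.1.eq_or_lt with rfl | ht0
  · rw [symmProduct_zero, nonsymmProduct_zero, expNeg_zero, sub_self, norm_zero, and_self]
    positivity
  obtain ⟨τ, rfl⟩ : ∃ τ, t = n * τ := ⟨t / n, by field_simp⟩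
  have hτ : 0 < τ := by
    by_contra! h
    nlinarith
  have hτL : τ ≤ L := by nlinarith [ht.2]
  obtain ⟨rF, rG, hF1, hF2, hG1, hG2, hDF, hDG, har, her⟩ := hr τ hτ
  have hD : ‖rF - rG‖ ≤ 2 * c * τ := by
    calc ‖rF - rG‖ = ‖(rF - invOneAdd (A + B)) - (rG - invOneAdd (A + B))‖ := by
          rw [sub_sub_sub_cancel_right]
      _ ≤ _ := (norm_sub_le _ _).trans (by linarith)
  refine norm_products_sub_le hA hB hH hτ hn hG2 har her hC hc.le (by positivity)
    (fun m hm => ?_) (fun m hm hmn => ?_)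
  · refine norm_generator_mul_pow_le hτ (hS.expNeg_nonneg hτ.le) (hS.expNeg_le_one hτ.le)
      (le_trans ?_ ht.2)
    have : (m + 1 : ℝ) ≤ n := by exact_mod_cast hm
    gcongr
  · refine (norm_pow_sub_pow_le_exp hτ (symmStep_nonneg hA hB hτ.le) (symmStep_le_one hA hB hτ.le)
      (hS.expNeg_nonneg hτ.le) (hS.expNeg_le_one hτ.le) hF1 hG2 hD hm).trans ?_
    have h1 : (m : ℝ) * τ ≤ L := by
      have : (m : ℝ) ≤ n := by exact_mod_cast hmn
      calc (m : ℝ) * τ ≤ n * τ := by gcongr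
        _ ≤ L := ht.2
    calc _ ≤ Real.exp L * (40 * ((1 + L) * (2 * c)) / m) := by gcongr
      _ = C / m := by rw [hCdef]; ring

/-- By the C⋆-identity ‖F(r)‖ = ‖e^{-rA/2}e^{-rB/2}‖², and increasing r only inserts further
contractions on the outer sides. -/
theorem norm_symmStep_anti (hA : IsNonnegSelfAdjoint A) (hB : IsNonnegSelfAdjoint B) {s t : ℝ}
    (hs : 0 ≤ s) (hst : s ≤ t) : ‖symmStep A B t‖ ≤ ‖symmStep A B s‖ := by
  have key : ∀ r, 0 ≤ r → ‖symmStep A B r‖ = ‖expNeg A (r / 2) * expNeg B (r / 2)‖ ^ 2 :=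
    fun r hr => by
      have hr2 : 0 ≤ r / 2 := by positivity
      have h1 := (IsSelfAdjoint.of_nonneg (hA.expNeg_nonneg hr2)).star_eq
      have h2 := (IsSelfAdjoint.of_nonneg (hB.expNeg_nonneg hr2)).star_eq
      rw [sq, ← CStarRing.norm_star_mul_self, star_mul, h1, h2, symmStep,
        ← expNeg_half_mul_self hA hr]
      simp only [mul_assoc]
  have h0 : 0 ≤ (t - s) / 2 := by linarith
  have hs2 : 0 ≤ s / 2 := by positivity
  rw [key t (hs.trans hst), key s hs]
  gcongr
  have e : expNeg A (t / 2) * expNeg B (t / 2) =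
      expNeg A ((t - s) / 2) * (expNeg A (s / 2) * expNeg B (s / 2)) * expNeg B ((t - s) / 2) := by
    rw [show t / 2 = (t - s) / 2 + s / 2 by ring, hA.expNeg_add h0 hs2,
      show (t - s) / 2 + s / 2 = s / 2 + (t - s) / 2 by ring, hB.expNeg_add hs2 h0]
    simp only [mul_assoc]
  rw [e]
  calc _ ≤ ‖expNeg A ((t - s) / 2)‖ * ‖expNeg A (s / 2) * expNeg B (s / 2)‖ *
        ‖expNeg B ((t - s) / 2)‖ :=
        (norm_mul_le _ _).trans (mul_le_mul_of_nonneg_right (norm_mul_le _ _) (norm_nonneg _))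
    _ ≤ 1 * ‖expNeg A (s / 2) * expNeg B (s / 2)‖ * 1 := by
        gcongr
        · exact hA.norm_expNeg_le_one h0
        · exact hB.norm_expNeg_le_one h0
    _ = _ := by ring

theorem norm_expNeg_anti (hA : IsNonnegSelfAdjoint A) {s t : ℝ}
    (hs : 0 ≤ s) (hst : s ≤ t) : ‖expNeg A t‖ ≤ ‖expNeg A s‖ := by
  rw [← sub_add_cancel t s, hA.expNeg_add (by linarith) hs]
  calc _ ≤ ‖expNeg A (t - s)‖ * ‖expNeg A s‖ := norm_mul_le _ _
    _ ≤ 1 * ‖expNeg A s‖ := by gcongr; exact hA.norm_expNeg_le_one (by linarith)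
    _ = _ := one_mul _

theorem norm_invOneAdd_le (hA : IsNonnegSelfAdjoint A) {η : ℝ} (hη : 0 < η)
    (h : ∀ x : A.domain, η * ‖(x : E)‖ ^ 2 ≤ (⟪A x, (x : E)⟫_ℂ).re) :
    ‖invOneAdd A‖ ≤ (1 + η)⁻¹ := by
  refine ContinuousLinearMap.opNorm_le_bound _ (by positivity) fun f => ?_
  obtain ⟨u, hu, rfl⟩ := hA.exists_invOneAdd_apply f
  rw [hu, inv_mul_eq_div, le_div_iff₀ (by positivity)]
  have h1 := h u
  have h2 : (⟪(u : E) + A u, (u : E)⟫_ℂ).re ≤ ‖(u : E) + A u‖ * ‖(u : E)‖ :=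
    (Complex.re_le_norm _).trans (norm_inner_le_norm _ _)
  rw [inner_add_left, Complex.add_re] at h2
  have h3 : (⟪(u : E), (u : E)⟫_ℂ).re = ‖(u : E)‖ ^ 2 := by
    simpa using inner_self_eq_norm_sq (𝕜 := ℂ) (u : E)
  rcases (norm_nonneg (u : E)).eq_or_lt with h4 | h4
  · rw [← h4, zero_mul]; positivity
  · nlinarith

/-- The size of τ = t/n decides. Up to a threshold τ₀ both discrete resolvents have norm at most ρ <
1; beyond it both single steps have norm at most q < 1, and each product is small by itself. -/
theorem exists_error_bound_on_Ici (hA : IsNonnegSelfAdjoint A) (hB : IsNonnegSelfAdjoint B)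
    (hH : IsSelfAdjoint (A + B)) (hpos : HasPositiveLowerBound (A + B)) :
    ∃ C : ℝ, ∀ n : ℕ, 1 ≤ n → ∀ t ∈ Set.Ici (0 : ℝ),
      ‖symmProduct A B n t - expNeg (A + B) t‖ ≤ C / n ∧
      ‖nonsymmProduct A B n t - expNeg (A + B) t‖ ≤ C / n := by
  have hS := hA.add hB hH
  obtain ⟨η, hη, hlow⟩ := hpos
  obtain ⟨c, hc, hr⟩ := exists_resolvent_estimates hA hB hH
  have hRn := norm_invOneAdd_le hS hη hlow
  have hη1 : (1 + η)⁻¹ < 1 := inv_lt_one_of_one_lt₀ (by linarith)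
  obtain ⟨ρ, hρ1, hρ2⟩ := exists_between hη1
  -- The threshold solves (1+η)⁻¹ + cτ₀ = ρ.
  obtain ⟨τ₀, hτ₀⟩ : ∃ τ₀, τ₀ = (ρ - (1 + η)⁻¹) / c := ⟨_, rfl⟩
  have hτ₀0 : 0 < τ₀ := by rw [hτ₀]; exact div_pos (by linarith) hc
  have hsmall : ∀ τ, τ ≤ τ₀ → ∀ r : E →L[ℂ] E, ‖r - invOneAdd (A + B)‖ ≤ c * τ → ‖r‖ ≤ ρ :=
    fun τ hτ r hr => by
      have h1 : c * τ ≤ ρ - (1 + η)⁻¹ := by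
        rw [hτ₀, le_div_iff₀ hc] at hτ; linarith
      have h2 := norm_le_norm_sub_add r (invOneAdd (A + B))
      linarith
  obtain ⟨q, hq1, hqF, hqG⟩ : ∃ q < 1, ‖symmStep A B τ₀‖ ≤ q ∧ ‖expNeg (A + B) τ₀‖ ≤ q := by
    obtain ⟨rF, rG, hF1, hF2, hG1, hG2, hDF, hDG, -, -⟩ := hr τ₀ hτ₀0
    refine ⟨max ‖symmStep A B τ₀‖ ‖expNeg (A + B) τ₀‖, max_lt ?_ ?_, le_max_left _ _,
      le_max_right _ _⟩
    · exact norm_lt_one_of_norm_resolvent_lt hτ₀0 (symmStep_nonneg hA hB hτ₀0.le)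
        (symmStep_le_one hA hB hτ₀0.le) hF1 hF2 ((hsmall _ le_rfl _ hDF).trans_lt hρ2)
    · exact norm_lt_one_of_norm_resolvent_lt hτ₀0 (hS.expNeg_nonneg hτ₀0.le)
        (hS.expNeg_le_one hτ₀0.le) hG1 hG2 ((hsmall _ le_rfl _ hDG).trans_lt hρ2)
  have hρ' : 0 ≤ (1 - ρ)⁻¹ := inv_nonneg.2 (by linarith)
  have hq' : 0 ≤ (1 - q)⁻¹ := inv_nonneg.2 (by linarith)
  obtain ⟨C, hCdef⟩ : ∃ C, C = 40 * ((1 - ρ)⁻¹ * (2 * c) * (1 - ρ)⁻¹) := ⟨_, rfl⟩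
  have hC : 0 ≤ C := by rw [hCdef]; positivity
  obtain ⟨C', hC'⟩ : ∃ C', C' = 2 * C + 3 * (c * (1 - ρ)⁻¹) + 1 + 2 * (1 - q)⁻¹ := ⟨_, rfl⟩
  refine ⟨C', fun n hn t ht => ?_⟩
  have hn1 : (1 : ℝ) ≤ n := by exact_mod_cast hn
  have hC'0 : 0 ≤ C' := by rw [hC']; positivity
  rcases (Set.mem_Ici.1 ht).eq_or_lt with rfl | ht0
  · rw [symmProduct_zero, nonsymmProduct_zero, expNeg_zero, sub_self, norm_zero, and_self]
    positivity
  obtain ⟨τ, rfl⟩ : ∃ τ, t = n * τ := ⟨t / n, by field_simp⟩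
  have hτ : 0 < τ := by
    by_contra! h
    nlinarith
  rcases le_total τ τ₀ with hle | hge
  · obtain ⟨rF, rG, hF1, hF2, hG1, hG2, hDF, hDG, har, her⟩ := hr τ hτ
    have hD : ‖rF - rG‖ ≤ 2 * c * τ := by
      calc ‖rF - rG‖ = ‖(rF - invOneAdd (A + B)) - (rG - invOneAdd (A + B))‖ := by
            rw [sub_sub_sub_cancel_right]
        _ ≤ _ := (norm_sub_le _ _).trans (by linarith)
    have hρF := hsmall _ hle _ hDF
    have hρG := hsmall _ hle _ hDG
    have h := norm_products_sub_le hA hB hH hτ hn hG2 har her hC hc.le hρ'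
      (fun m hm => norm_generator_mul_pow_le_of_norm_resolvent_le hτ (hS.expNeg_nonneg hτ.le)
        (hS.expNeg_le_one hτ.le) hG2 hρG hρ2 m)
      (fun m hm hmn => by
        rw [hCdef]
        exact norm_pow_sub_pow_le_of_norm_resolvent_le hτ (symmStep_nonneg hA hB hτ.le)
          (symmStep_le_one hA hB hτ.le) (hS.expNeg_nonneg hτ.le) (hS.expNeg_le_one hτ.le) hF1 hG2
          hD hρF hρG hρ2 hm)
    have hmono : (2 * C + 3 * (c * (1 - ρ)⁻¹) + 1) / n ≤ C' / n := by
      rw [hC']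
      exact div_le_div_of_nonneg_right (by linarith) (by positivity)
    exact ⟨h.1.trans hmono, h.2.trans hmono⟩
  · have hF := (norm_symmStep_anti hA hB hτ₀0.le hge).trans hqF
    have hG := (norm_expNeg_anti hS hτ₀0.le hge).trans hqG
    have hτ2 : 0 ≤ τ / 2 := by positivity
    rw [symmProduct_eq hn rfl, nonsymmProduct_eq hn rfl, ← hS.expNeg_pow hτ.le]
    obtain ⟨m, rfl⟩ : ∃ m, n = m + 1 := ⟨n - 1, by omega⟩
    have hmono : (1 - q)⁻¹ / (m + 1) + (1 - q)⁻¹ / (m + 1) ≤ C' / ((m + 1 : ℕ) : ℝ) := by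
      push_cast
      rw [← add_div]
      gcongr
      rw [hC', ← two_mul, le_add_iff_nonneg_left]
      positivity
    have hsucc : (1 - q)⁻¹ / (((m + 1 : ℕ) : ℝ) + 1) ≤ (1 - q)⁻¹ / (m + 1) := by
      push_cast; gcongr; linarith
    have bG := (norm_pow_le_div hG hq1 (m + 1)).trans hsucc
    constructor
    · exact (norm_sub_le _ _).trans
        ((add_le_add ((norm_pow_le_div hF hq1 (m + 1)).trans hsucc) bG).trans hmono)
    · refine (norm_sub_le _ _).trans ((add_le_add ?_ bG).trans hmono)
      rw [← expNeg_half_mul_self hB hτ.le, mul_mul_self_pow_succ]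
      have ha := hA.norm_expNeg_le_one hτ.le
      have he := hB.norm_expNeg_le_one hτ2
      calc _ ≤ ‖expNeg A τ‖ * ‖expNeg B (τ / 2)‖ * ‖symmStep A B τ ^ m‖ * ‖expNeg B (τ / 2)‖ :=
            (norm_mul_le _ _).trans (mul_le_mul_of_nonneg_right ((norm_mul_le _ _).trans
              (mul_le_mul_of_nonneg_right (norm_mul_le _ _) (norm_nonneg _))) (norm_nonneg _))
        _ ≤ 1 * 1 * ((1 - q)⁻¹ / (m + 1)) * 1 := by
            have := norm_pow_le_div hF hq1 m
            gcongr
        _ = _ := by ring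

end ErrorBounds

/-! ### The semigroup on eigenvectors -/

section Eigenvectors

variable {E : Type*} [NormedAddCommGroup E] [InnerProductSpace ℂ E] [CompleteSpace E]

theorem differentiableAt_expFun (t : ℝ) {x : ℝ} (hx : x ≠ 0) :
    DifferentiableAt ℝ (expFun t) x := by
  have : (fun x : ℝ => Real.exp (-t * (x⁻¹ - 1))) =ᶠ[nhds x] expFun t := by
    filter_upwards [isOpen_ne.mem_nhds hx] with y hy
    rw [expFun_of_ne_zero _ hy]
  refine DifferentiableAt.congr_of_eventuallyEq ?_ this.symm
  fun_prop (disch := assumption)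

/-- An eigenvector of A is one of X = (1+A)⁻¹, with eigenvalue r = (1+a)⁻¹ ≠ 0. The function f =
`expFun t` is differentiable at r, so its difference quotient at r is continuous on the spectrum and
f(X) - f(r) has the right factor X - r, which kills u. -/
theorem IsNonnegSelfAdjoint.expNeg_apply_of_eigenvector {A : E →ₗ.[ℂ] E}
    (hA : IsNonnegSelfAdjoint A) {u : A.domain} {a : ℝ} (ha : 0 ≤ a)
    (hu : A u = (a : ℂ) • (u : E)) {t : ℝ} (ht : 0 ≤ t) :
    expNeg A t u = (Real.exp (-t * a) : ℂ) • (u : E) := by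
  rcases ht.eq_or_lt with rfl | ht
  · simp [expNeg_zero]
  obtain ⟨r, hr⟩ : ∃ r : ℝ, r = (1 + a)⁻¹ := ⟨_, rfl⟩
  have h1a : (0 : ℝ) < 1 + a := by linarith
  have hr0 : r ≠ 0 := by rw [hr]; positivity
  obtain ⟨X, hXdef⟩ : ∃ X, X = invOneAdd A := ⟨_, rfl⟩
  have hX : X u = (r : ℂ) • (u : E) := by
    have h1 := hA.invOneAdd_add_apply u
    rw [hu, ← hXdef] at h1
    have h2 : (u : E) + (a : ℂ) • (u : E) = ((1 + a : ℝ) : ℂ) • (u : E) := by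
      push_cast; rw [add_smul, one_smul]
    rw [h2, map_smul] at h1
    have h3 := congrArg (fun v => (r : ℂ) • v) h1
    simp only [smul_smul] at h3
    rwa [hr, ← Complex.ofReal_mul, inv_mul_cancel₀ h1a.ne', Complex.ofReal_one, one_smul,
      ← hr] at h3
  have hs : spectrum ℝ X ⊆ Set.Icc 0 1 := hXdef ▸
    spectrum_subset_Icc hA.invOneAdd_nonneg hA.invOneAdd_le_one
  have hXs : IsSelfAdjoint X := hXdef ▸ IsSelfAdjoint.of_nonneg hA.invOneAdd_nonneg
  have hf : ContinuousOn (expFun t) (spectrum ℝ X) := (continuousOn_expFun ht).mono hs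
  have hg : ContinuousOn (dslope (expFun t) r) (spectrum ℝ X) := fun x hx => by
    rcases eq_or_ne x r with rfl | h
    · exact (continuousAt_dslope_same.2 (differentiableAt_expFun t hr0)).continuousWithinAt
    · exact (continuousWithinAt_dslope_of_ne h).2 (hf x hx)
  have e1 : cfc (expFun t) X = cfc (dslope (expFun t) r) X * (X - algebraMap ℝ _ r) +
      algebraMap ℝ _ (expFun t r) := by
    have e2 : expFun t = fun x => dslope (expFun t) r x * (x - r) + expFun t r := by
      funext x
      have := sub_smul_dslope (expFun t) r x
      rw [smul_eq_mul] at this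
      linarith
    conv_lhs => rw [e2]
    rw [cfc_add (a := X) (fun x => dslope (expFun t) r x * (x - r)) (fun _ => expFun t r),
      cfc_mul (dslope (expFun t) r) (fun x => x - r) X,
      cfc_sub (fun x => x) (fun _ => r) X, cfc_id' ℝ X, cfc_const r X, cfc_const (expFun t r) X]
  have hal : ∀ s : ℝ, (algebraMap ℝ (E →L[ℂ] E) s) u = (s : ℂ) • (u : E) := fun s => by
    rw [Algebra.algebraMap_eq_smul_one]; rfl
  rw [expNeg_of_ne_zero ht.ne', ← hXdef, e1, add_apply, mul_apply_eq_comp,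
    sub_apply, hX, hal, sub_self, map_zero, zero_add, hal, expFun_of_ne_zero _ hr0, hr, inv_inv,
    add_sub_cancel_left]

end Eigenvectors

/-! ### Direct sums of bounded blocks -/

section BlockOperators

variable {I : Type*} {V : Type*} [NormedAddCommGroup V] [InnerProductSpace ℂ V]

/-- The orthogonal direct sum of bounded operators, on its maximal domain. -/
noncomputable def blockOp (T : I → V →L[ℂ] V) :
    lp (fun _ : I => V) 2 →ₗ.[ℂ] lp (fun _ : I => V) 2 where
  domain :=
    { carrier := {x | Memℓp (fun i => T i (x i)) 2}
      add_mem' := fun {x y} hx hy => by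
        have : (fun i => T i ((x + y) i)) = (fun i => T i (x i)) + fun i => T i (y i) := by
          funext i; simp
        change Memℓp (fun i => T i ((x + y) i)) 2
        rw [this]; exact Memℓp.add hx hy
      zero_mem' := by
        have : (fun i => T i ((0 : lp (fun _ : I => V) 2) i)) = 0 := by funext i; simp
        change Memℓp (fun i => T i ((0 : lp (fun _ : I => V) 2) i)) 2
        rw [this]; exact zero_memℓp
      smul_mem' := fun c x hx => by
        have : (fun i => T i ((c • x) i)) = c • fun i => T i (x i) := by funext i; simp
        change Memℓp (fun i => T i ((c • x) i)) 2
        rw [this]; exact Memℓp.const_smul hx c }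
  toFun :=
    { toFun := fun x => ⟨fun i => T i (x.1 i), x.2⟩
      map_add' := fun x y => by ext i : 2; exact map_add (T i) _ _
      map_smul' := fun c x => by ext i : 2; exact map_smul (T i) _ _ }

theorem mem_blockOp_domain {T : I → V →L[ℂ] V} {x : lp (fun _ : I => V) 2} :
    x ∈ (blockOp T).domain ↔ Memℓp (fun i => T i (x i)) 2 := Iff.rfl

theorem blockOp_apply (T : I → V →L[ℂ] V) (x : (blockOp T).domain) (i : I) :
    (blockOp T x) i = T i (x.1 i) := rfl

/-- If (S+T)x is square summable, so are 2Sx and 2Tx, because S - T is bounded. Hence the sum has no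
larger domain than the intersection. -/
theorem blockOp_add {S T : I → V →L[ℂ] V} {C : ℝ} (h : ∀ i v, ‖S i v - T i v‖ ≤ C * ‖v‖) :
    blockOp S + blockOp T = blockOp fun i => S i + T i := by
  refine LinearPMap.ext ?_ fun x hx hy => ?_
  · ext x
    rw [LinearPMap.add_domain, Submodule.mem_inf, mem_blockOp_domain, mem_blockOp_domain,
      mem_blockOp_domain]
    constructor
    · rintro ⟨h1, h2⟩; exact h1.add h2
    · intro h1
      have h2 : Memℓp (fun i => S i (x i) - T i (x i)) 2 := by
        refine Memℓp.mono (g := fun i => C * ‖x i‖) ?_ fun i => h i (x i)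
        exact Memℓp.const_mul (memℓp_norm_iff.2 (lp.memℓp x)) C
      have h3 := (h1.add h2).const_smul (2⁻¹ : ℂ)
      have h4 := (h1.sub h2).const_smul (2⁻¹ : ℂ)
      refine ⟨(congrArg (Memℓp · 2) (funext fun i => ?_)).mp h3,
        (congrArg (Memℓp · 2) (funext fun i => ?_)).mp h4⟩
      · simp only [Pi.smul_apply, Pi.add_apply, add_apply]
        rw [add_add_sub_cancel, ← two_smul ℂ, smul_smul]; norm_num
      · simp only [Pi.smul_apply, Pi.sub_apply, add_apply]
        rw [add_sub_sub_cancel, ← two_smul ℂ, smul_smul]; norm_num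
  · ext i : 2
    rw [LinearPMap.add_apply]
    rfl

theorem blockOp_single_mem [DecidableEq I] (T : I → V →L[ℂ] V) (i : I) (v : V) :
    lp.single 2 i v ∈ (blockOp T).domain := by
  rw [mem_blockOp_domain]
  have : (fun j => T j ((lp.single 2 i v : lp (fun _ : I => V) 2) j)) =
      (lp.single 2 i (T i v) : lp (fun _ : I => V) 2) := by
    funext j
    rcases eq_or_ne j i with rfl | h
    · simp
    · rw [lp.single_apply_ne _ _ _ h, lp.single_apply_ne _ _ _ h, map_zero]
  rw [this]
  exact lp.memℓp _

theorem blockOp_single [DecidableEq I] (T : I → V →L[ℂ] V) (i : I) (v : V) :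
    blockOp T ⟨lp.single 2 i v, blockOp_single_mem T i v⟩ = lp.single 2 i (T i v) := by
  ext j : 2
  rw [blockOp_apply]
  change T j ((lp.single 2 i v : lp (fun _ : I => V) 2) j) = _
  rcases eq_or_ne j i with rfl | h
  · simp
  · rw [lp.single_apply_ne _ _ _ h, lp.single_apply_ne _ _ _ h, map_zero]

theorem dense_blockOp_domain (T : I → V →L[ℂ] V) :
    Dense ((blockOp T).domain : Set (lp (fun _ : I => V) 2)) := by
  classical
  intro x
  have h := lp.hasSum_single (p := 2) (by norm_num) x
  exact mem_closure_of_tendsto h (Filter.Eventually.of_forall fun s =>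
    Submodule.sum_mem _ fun i _ => blockOp_single_mem T i (x i))

/-- The orthogonal direct sum of the multiples `k i` of the projections onto the lines spanned by
the unit vectors `a i`. -/
noncomputable def projOp (k : I → ℝ) (a : I → V) :
    lp (fun _ : I => V) 2 →ₗ.[ℂ] lp (fun _ : I => V) 2 :=
  blockOp fun i => (k i : ℂ) • InnerProductSpace.rankOne ℂ (a i) (a i)

variable {k : I → ℝ} {a b : I → V}

theorem projOp_single_mem [DecidableEq I] (k : I → ℝ) (a : I → V) (i : I) (v : V) :
    lp.single 2 i v ∈ (projOp k a).domain := blockOp_single_mem _ i v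

theorem projOp_single [DecidableEq I] (k : I → ℝ) (a : I → V) (i : I) (v : V) :
    projOp k a ⟨lp.single 2 i v, projOp_single_mem k a i v⟩ =
      lp.single 2 i ((k i : ℂ) • ⟪a i, v⟫_ℂ • a i) := by
  refine (blockOp_single _ i v).trans ?_
  rw [smul_apply, InnerProductSpace.rankOne_apply]

theorem projOp_add {C : ℝ} (hk : ∀ i, 0 ≤ k i) (ha : ∀ i, ‖a i‖ = 1)
    (hb : ∀ i, ‖b i‖ = 1) (hC : ∀ i, k i * ‖a i - b i‖ ≤ C) :
    projOp k a + projOp k b = blockOp (fun i =>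
      (k i : ℂ) • InnerProductSpace.rankOne ℂ (a i) (a i) +
      (k i : ℂ) • InnerProductSpace.rankOne ℂ (b i) (b i)) := by
  refine blockOp_add (C := 2 * C) fun i v => ?_
  have e : ((k i : ℂ) • InnerProductSpace.rankOne ℂ (a i) (a i)) v -
      ((k i : ℂ) • InnerProductSpace.rankOne ℂ (b i) (b i)) v =
      (k i : ℂ) • (⟪a i - b i, v⟫_ℂ • a i + ⟪b i, v⟫_ℂ • (a i - b i)) := by
    simp only [smul_apply, InnerProductSpace.rankOne_apply, ← smul_sub, inner_sub_left]
    module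
  rw [e, norm_smul, Complex.norm_real, Real.norm_of_nonneg (hk i)]
  have h1 : ‖⟪a i - b i, v⟫_ℂ • a i‖ ≤ ‖a i - b i‖ * ‖v‖ := by
    rw [norm_smul, ha, mul_one]; exact norm_inner_le_norm _ _
  have h2 : ‖⟪b i, v⟫_ℂ • (a i - b i)‖ ≤ ‖v‖ * ‖a i - b i‖ := by
    rw [norm_smul]
    gcongr
    simpa [hb] using norm_inner_le_norm (𝕜 := ℂ) (b i) v
  calc _ ≤ k i * (‖a i - b i‖ * ‖v‖ + ‖v‖ * ‖a i - b i‖) := by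
        gcongr
        · exact hk i
        · exact (norm_add_le _ _).trans (add_le_add h1 h2)
    _ = 2 * (k i * ‖a i - b i‖) * ‖v‖ := by ring
    _ ≤ _ := by gcongr; exact hC i

variable [CompleteSpace V]

/-- Testing against vectors supported in a single block shows that the adjoint acts blockwise by T.
Its values are square summable, which is the condition defining the maximal domain. -/
theorem isNonnegSelfAdjoint_blockOp {T : I → V →L[ℂ] V}
    (hT : ∀ i v w, ⟪T i v, w⟫_ℂ = ⟪v, T i w⟫_ℂ) (hT0 : ∀ i v, 0 ≤ (⟪T i v, v⟫_ℂ).re) :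
    IsNonnegSelfAdjoint (blockOp T) := by
  classical
  have hd := dense_blockOp_domain T
  refine ⟨?_, fun x => ?_⟩
  · rw [LinearPMap.isSelfAdjoint_def]
    refine le_antisymm ?_ (LinearPMap.IsFormalAdjoint.le_adjoint hd fun x y => ?_)
    · have key : ∀ (y : (blockOp T).adjoint.domain) i,
          ((blockOp T).adjoint y) i = T i (y.1 i) := fun y i => by
        refine ext_inner_right ℂ fun v => ?_
        have h := (blockOp T).adjoint_isFormalAdjoint hd y
          ⟨lp.single 2 i v, blockOp_single_mem T i v⟩
        rw [blockOp_single] at h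
        have h' : ⟪(blockOp T).adjoint y, (lp.single 2 i v : lp (fun _ : I => V) 2)⟫_ℂ =
          ⟪(y : lp (fun _ : I => V) 2), (lp.single 2 i (T i v) : lp (fun _ : I => V) 2)⟫_ℂ := h
        rw [lp.inner_single_right, lp.inner_single_right] at h'
        rw [h', hT]
      refine ⟨fun y hy => ?_, fun y z hyz => ?_⟩
      · rw [mem_blockOp_domain]
        exact (congrArg (Memℓp · 2) (funext fun i => key ⟨y, hy⟩ i)).mp
          (lp.memℓp ((blockOp T).adjoint ⟨y, hy⟩))
      · ext i : 2
        rw [key, blockOp_apply, hyz]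
    · rw [lp.inner_eq_tsum, lp.inner_eq_tsum]
      exact tsum_congr fun i => hT i _ _
  · have h := (lp.hasSum_inner (𝕜 := ℂ) (blockOp T x) (x : lp (fun _ : I => V) 2))
    have h2 := Complex.hasSum_re h
    exact h2.nonneg fun i => hT0 i _

theorem isNonnegSelfAdjoint_projOp (hk : ∀ i, 0 ≤ k i) : IsNonnegSelfAdjoint (projOp k a) := by
  refine isNonnegSelfAdjoint_blockOp (fun i v w => ?_) fun i v => ?_
  · simp only [smul_apply, InnerProductSpace.rankOne_apply, inner_smul_left, inner_smul_right,
      Complex.conj_ofReal, inner_conj_symm]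
    ring
  · simp only [smul_apply, InnerProductSpace.rankOne_apply, inner_smul_left,
      Complex.conj_ofReal]
    rw [← Complex.normSq_eq_conj_mul_self, ← Complex.ofReal_mul, Complex.ofReal_re]
    exact mul_nonneg (hk i) (Complex.normSq_nonneg _)

/-- In block i the operator has eigenvalue k i along a i and 0 on the orthogonal complement; v is
split accordingly. -/
theorem expNeg_projOp_single [DecidableEq I] (hk : ∀ i, 0 ≤ k i) (ha : ∀ i, ‖a i‖ = 1) {t : ℝ}
    (ht : 0 ≤ t) (i : I) (v : V) : expNeg (projOp k a) t (lp.single 2 i v) =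
      lp.single 2 i (v - (((1 - Real.exp (-t * k i) : ℝ) : ℂ) * ⟪a i, v⟫_ℂ) • a i) := by
  have hS := isNonnegSelfAdjoint_projOp (a := a) hk
  have haa : ⟪a i, a i⟫_ℂ = 1 := by
    rw [inner_self_eq_norm_sq_to_K, ha]; simp
  have h1 : expNeg (projOp k a) t (lp.single 2 i (a i)) =
      (Real.exp (-t * k i) : ℂ) • lp.single 2 i (a i) := by
    refine hS.expNeg_apply_of_eigenvector (u := ⟨_, projOp_single_mem k a i (a i)⟩) (hk i) ?_ ht
    rw [projOp_single, ← lp.single_smul]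
    rw [haa, one_smul]
  have h2 : expNeg (projOp k a) t (lp.single 2 i (v - ⟪a i, v⟫_ℂ • a i)) =
      lp.single 2 i (v - ⟪a i, v⟫_ℂ • a i) := by
    have := hS.expNeg_apply_of_eigenvector
      (u := ⟨_, projOp_single_mem k a i (v - ⟪a i, v⟫_ℂ • a i)⟩) (a := 0) le_rfl ?_ ht
    · simpa using this
    rw [projOp_single]
    rw [inner_sub_right, inner_smul_right, haa]
    simp
  have e : v = (v - ⟪a i, v⟫_ℂ • a i) + ⟪a i, v⟫_ℂ • a i := by abel
  conv_lhs => rw [e]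
  rw [lp.single_add, lp.single_smul, map_add, map_smul, h1, h2, ← lp.single_smul,
    ← lp.single_smul, ← lp.single_add]
  congr 1
  push_cast
  module

end BlockOperators

/-! ### Scalar estimates for the example -/

section RealEstimates

/-- The quadratic is the characteristic polynomial of (1 - p aa*)(1 - p bb*) with p = 15/16 and
⟨a,b⟩ = 1 - 2σ²: its determinant is 1/256 and its trace is 1 + 1/256 - 4p²σ²(1-σ²). A sign change
locates a root. -/
theorem exists_eigenvalue {σ : ℝ} (h0 : 0 ≤ σ) (h1 : σ ≤ 1 / 10) :
    ∃ l : ℝ, 1 - 4 * σ ^ 2 ≤ l ∧ l ≤ 1 ∧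
      l ^ 2 - (1 + 1 / 256) * l + 1 / 256 + 225 / 64 * (σ ^ 2 * (1 - σ ^ 2)) * l = 0 := by
  have hs0 : 0 ≤ σ ^ 2 := sq_nonneg σ
  have hs1 : σ ^ 2 ≤ 1 / 100 := by nlinarith
  have hc : Continuous fun l : ℝ =>
    l ^ 2 - (1 + 1 / 256) * l + 1 / 256 + 225 / 64 * (σ ^ 2 * (1 - σ ^ 2)) * l := by fun_prop
  have h := intermediate_value_Icc (show 1 - 4 * σ ^ 2 ≤ 1 by linarith) hc.continuousOn
  have hm : (0 : ℝ) ∈ Set.Icc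
      ((1 - 4 * σ ^ 2) ^ 2 - (1 + 1 / 256) * (1 - 4 * σ ^ 2) + 1 / 256 +
        225 / 64 * (σ ^ 2 * (1 - σ ^ 2)) * (1 - 4 * σ ^ 2))
      ((1 : ℝ) ^ 2 - (1 + 1 / 256) * 1 + 1 / 256 + 225 / 64 * (σ ^ 2 * (1 - σ ^ 2)) * 1) := by
    generalize σ ^ 2 = s at hs0 hs1
    constructor
    · have h2 : 0 ≤ s * (1 / 100 - s) := mul_nonneg hs0 (by linarith)
      have h3 : 0 ≤ s ^ 2 * (1 / 100 - s) := mul_nonneg (sq_nonneg s) (by linarith)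
      have h4 := pow_nonneg hs0 3
      nlinarith
    · nlinarith
  obtain ⟨l, ⟨hl1, hl2⟩, hl⟩ := h hm
  exact ⟨l, hl1, hl2, hl⟩

/-- Because 8 log 2 lies between 11/2 and 6, the exponential μ satisfies 1 - 6σ² ≤ μ ≤ 1 - 5σ²,
hence μ(1+σ²) ≤ l. Bernoulli's inequality gives l^n ≥ μ^n(1 + nσ²) and μ^n ≥ 1/2. -/
theorem pow_sub_exp_pow_ge {σ l : ℝ} {n : ℕ} (hn : 1 ≤ n) (h0 : 0 ≤ σ) (h1 : σ ≤ 1 / (10 * n))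
    (hl : 1 - 4 * σ ^ 2 ≤ l) :
    n * σ ^ 2 / 2 ≤ l ^ n - Real.exp (-(8 * Real.log 2 * σ ^ 2)) ^ n := by
  have hn1 : (1 : ℝ) ≤ n := by exact_mod_cast hn
  have hs0 : 0 ≤ σ ^ 2 := sq_nonneg σ
  have hs1 : n * σ ^ 2 ≤ 1 / 100 := by
    rw [le_div_iff₀ (by positivity)] at h1
    have h2 : σ * (10 * n) * (σ * (10 * n)) ≤ 1 * 1 := by gcongr
    nlinarith
  have hs2 : σ ^ 2 ≤ 1 / 100 := by nlinarith
  have hlog1 := Real.log_two_gt_d9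
  have hlog2 := Real.log_two_lt_d9
  obtain ⟨z, hz⟩ : ∃ z, z = 8 * Real.log 2 * σ ^ 2 := ⟨_, rfl⟩
  rw [← hz]
  generalize σ ^ 2 = s at *
  have hz1 : 11 / 2 * s ≤ z := by rw [hz]; nlinarith
  have hz2 : z ≤ 6 * s := by rw [hz]; nlinarith
  have hm1 : Real.exp (-z) ≤ 1 - 5 * s := by
    rw [Real.exp_neg, inv_le_comm₀ (Real.exp_pos _) (by linarith)]
    refine le_trans ?_ (Real.add_one_le_exp z)
    rw [inv_le_iff_one_le_mul₀ (by linarith)]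
    nlinarith
  have hm2 : 1 - 6 * s ≤ Real.exp (-z) := by linarith [Real.add_one_le_exp (-z)]
  have hm0 := Real.exp_pos (-z)
  generalize Real.exp (-z) = μ at *
  have hp1 : 1 / 2 ≤ μ ^ n := by
    have h2 := one_add_mul_le_pow (show (-2 : ℝ) ≤ μ - 1 by linarith) n
    rw [add_sub_cancel] at h2
    nlinarith
  have hp2 : μ ^ n * (1 + n * s) ≤ l ^ n := by
    have h2 := one_add_mul_le_pow (show (-2 : ℝ) ≤ s by linarith) n
    calc μ ^ n * (1 + n * s) ≤ μ ^ n * (1 + s) ^ n := by gcongr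
      _ = (μ * (1 + s)) ^ n := (mul_pow _ _ _).symm
      _ ≤ l ^ n := by
        gcongr
        nlinarith
  have h3 : 0 ≤ (n : ℝ) * s := by positivity
  nlinarith

end RealEstimates

/-! ### Real vectors in the plane -/

section Vectors

/-- The vector with the real coordinates `x` and `y`. -/
noncomputable def realVec (x y : ℝ) : EuclideanSpace ℂ (Fin 2) := !₂[(x : ℂ), (y : ℂ)]

theorem realVec_add (x y x' y' : ℝ) :
    realVec x y + realVec x' y' = realVec (x + x') (y + y') := by
  ext i; fin_cases i <;> simp [realVec]

theorem realVec_sub (x y x' y' : ℝ) :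
    realVec x y - realVec x' y' = realVec (x - x') (y - y') := by
  ext i; fin_cases i <;> simp [realVec]

theorem smul_realVec (r x y : ℝ) : (r : ℂ) • realVec x y = realVec (r * x) (r * y) := by
  ext i; fin_cases i <;> simp [realVec]

theorem inner_realVec (x y x' y' : ℝ) :
    ⟪realVec x y, realVec x' y'⟫_ℂ = ((x * x' + y * y' : ℝ) : ℂ) := by
  simp [realVec, PiLp.inner_apply, Fin.sum_univ_two, mul_comm]

theorem norm_realVec_sq (x y : ℝ) : ‖realVec x y‖ ^ 2 = x ^ 2 + y ^ 2 := by
  have h := inner_self_eq_norm_sq (𝕜 := ℂ) (realVec x y)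
  rw [← h, inner_realVec]
  simp [sq]

theorem norm_realVec_eq_one {x y : ℝ} (h : x ^ 2 + y ^ 2 = 1) : ‖realVec x y‖ = 1 := by
  have h1 := norm_realVec_sq x y
  rw [h] at h1
  exact (pow_eq_one_iff_of_nonneg (norm_nonneg _) two_ne_zero).1 h1

theorem norm_realVec_le {x y : ℝ} (h : |y| ≤ x) : ‖realVec x y‖ ≤ 2 * x := by
  have hx : 0 ≤ x := (abs_nonneg y).trans h
  refine abs_le_of_sq_le_sq' ?_ (by positivity) |>.2
  rw [norm_realVec_sq]
  nlinarith [sq_abs y, abs_nonneg y]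

end Vectors

/-! ### The example: pairs of nearly parallel projections -/

section Optimality

variable {E : Type*} [NormedAddCommGroup E] [InnerProductSpace ℂ E]

theorem pow_apply_of_eigenvector {T : E →L[ℂ] E} {w : E} {l : ℂ} (h : T w = l • w) (n : ℕ) :
    (T ^ n) w = l ^ n • w := by
  induction n with
  | zero => simp
  | succ n ih => rw [pow_succ, mul_apply_eq_comp, h, map_smul, ih, smul_smul, pow_succ']

/-- The matrix element of T^n - G between the two eigenvectors is computed exactly. Only G has to be
selfadjoint, so T may be the nonsymmetric step. -/
theorem sub_mul_norm_inner_le [CompleteSpace E] {T G : E →L[ℂ] E} (hG : IsSelfAdjoint G) {w h : E} {l μ : ℝ}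
    (hT : T w = (l : ℂ) • w) (hh : G h = (μ : ℂ) • h) (n : ℕ) :
    (l ^ n - μ) * ‖⟪h, w⟫_ℂ‖ ≤ ‖T ^ n - G‖ * (‖h‖ * ‖w‖) := by
  have e : ⟪h, (T ^ n - G) w⟫_ℂ = ((l ^ n - μ : ℝ) : ℂ) * ⟪h, w⟫_ℂ := by
    have h1 : ⟪h, G w⟫_ℂ = ⟪G h, w⟫_ℂ := by
      rw [← ContinuousLinearMap.adjoint_inner_left, ← ContinuousLinearMap.star_eq_adjoint,
        hG.star_eq]
    rw [sub_apply, inner_sub_right, pow_apply_of_eigenvector hT, inner_smul_right, h1, hh,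
      inner_smul_left, Complex.conj_ofReal]
    push_cast; ring
  calc (l ^ n - μ) * ‖⟪h, w⟫_ℂ‖ ≤ ‖((l ^ n - μ : ℝ) : ℂ) * ⟪h, w⟫_ℂ‖ := by
        rw [norm_mul, Complex.norm_real]
        gcongr
        exact Real.le_norm_self _
    _ ≤ ‖h‖ * ‖(T ^ n - G) w‖ := by rw [← e]; exact norm_inner_le_norm _ _
    _ ≤ ‖h‖ * (‖T ^ n - G‖ * ‖w‖) := by gcongr; exact ContinuousLinearMap.le_opNorm _ _
    _ = _ := by ring

/-- The indices `(k, σ)` of the blocks of the example. -/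
abbrev BlockIndex : Type :=
  {p : ℝ × ℝ // 0 ≤ p.1 ∧ 0 ≤ p.2 ∧ p.2 ≤ 1 ∧ p.1 * p.2 ≤ 1}

/-- The weight of a block. -/
def blockWeight (i : BlockIndex) : ℝ := i.1.1

/-- The unit vector whose first coordinate is `σ`. -/
noncomputable def upperVec (i : BlockIndex) : EuclideanSpace ℂ (Fin 2) :=
  realVec i.1.2 (Real.sqrt (1 - i.1.2 ^ 2))

/-- The unit vector whose first coordinate is `-σ`. -/
noncomputable def lowerVec (i : BlockIndex) : EuclideanSpace ℂ (Fin 2) :=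
  realVec (-i.1.2) (Real.sqrt (1 - i.1.2 ^ 2))

theorem blockWeight_nonneg (i : BlockIndex) : 0 ≤ blockWeight i := i.2.1

theorem sq_sqrt_one_sub (i : BlockIndex) : Real.sqrt (1 - i.1.2 ^ 2) ^ 2 = 1 - i.1.2 ^ 2 :=
  Real.sq_sqrt (by nlinarith [i.2.2.1, i.2.2.2.1])

theorem norm_upperVec (i : BlockIndex) : ‖upperVec i‖ = 1 :=
  norm_realVec_eq_one (by rw [sq_sqrt_one_sub]; ring)

theorem norm_lowerVec (i : BlockIndex) : ‖lowerVec i‖ = 1 :=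
  norm_realVec_eq_one (by rw [sq_sqrt_one_sub]; ring)

/-- The constraint kσ ≤ 1 on the indices gives k‖a - b‖ = 2kσ ≤ 2, which keeps the difference of the
two operators bounded. -/
theorem projOp_upperVec_add_lowerVec :
    projOp blockWeight upperVec + projOp blockWeight lowerVec = blockOp (fun i =>
      (blockWeight i : ℂ) • InnerProductSpace.rankOne ℂ (upperVec i) (upperVec i) +
      (blockWeight i : ℂ) • InnerProductSpace.rankOne ℂ (lowerVec i) (lowerVec i)) := by
  refine projOp_add (C := 2) blockWeight_nonneg norm_upperVec norm_lowerVec fun i => ?_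
  have h1 : ‖upperVec i - lowerVec i‖ = 2 * i.1.2 := by
    have hs := i.2.2.1
    rw [upperVec, lowerVec, realVec_sub, ← abs_of_nonneg (norm_nonneg _),
      ← abs_of_nonneg (show 0 ≤ 2 * i.1.2 by linarith), ← sq_eq_sq_iff_abs_eq_abs, norm_realVec_sq]
    ring
  rw [h1, blockWeight]
  linarith [i.2.2.2.2]

theorem isSelfAdjoint_projOp_upperVec_add_lowerVec :
    IsSelfAdjoint (projOp blockWeight upperVec + projOp blockWeight lowerVec) := by
  rw [projOp_upperVec_add_lowerVec]
  refine (isNonnegSelfAdjoint_blockOp (fun i v w => ?_) fun i v => ?_).isSelfAdjoint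
  · simp only [add_apply, smul_apply, InnerProductSpace.rankOne_apply, inner_add_left,
      inner_add_right, inner_smul_left, inner_smul_right, Complex.conj_ofReal, inner_conj_symm]
    ring
  · simp only [add_apply, smul_apply, InnerProductSpace.rankOne_apply, inner_smul_left,
      inner_add_left, Complex.conj_ofReal]
    rw [← Complex.normSq_eq_conj_mul_self, ← Complex.normSq_eq_conj_mul_self,
      ← Complex.ofReal_mul, ← Complex.ofReal_mul, ← Complex.ofReal_add, Complex.ofReal_re]
    exact add_nonneg (mul_nonneg (blockWeight_nonneg i) (Complex.normSq_nonneg _))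
      (mul_nonneg (blockWeight_nonneg i) (Complex.normSq_nonneg _))

theorem isUnbounded_projOp {a : BlockIndex → EuclideanSpace ℂ (Fin 2)} (ha : ∀ i, ‖a i‖ = 1) :
    IsUnbounded (projOp blockWeight a) := by
  classical
  rintro ⟨C, hC⟩
  obtain ⟨i, hi⟩ : ∃ i : BlockIndex, C < blockWeight i :=
    -- With σ = 0 every weight k ≥ 0 is admissible.
    ⟨⟨(|C| + 1, 0), by positivity, le_rfl, zero_le_one, by simp⟩,
      by rw [blockWeight]; linarith [le_abs_self C]⟩
  have h := hC ⟨_, projOp_single_mem _ _ i (a i)⟩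
  rw [projOp_single] at h
  change _ ≤ C * ‖(lp.single 2 i (a i) : lp (fun _ : BlockIndex => EuclideanSpace ℂ (Fin 2)) 2)‖ at h
  rw [lp.norm_single (by norm_num), lp.norm_single (by norm_num), norm_smul, norm_smul, ha, inner_self_eq_norm_sq_to_K, ha,
    Complex.norm_real, Real.norm_of_nonneg (blockWeight_nonneg i)] at h
  simp at h
  linarith

theorem expNeg_upperVec_single [DecidableEq BlockIndex] {t : ℝ} (ht : 0 ≤ t) (i : BlockIndex)
    (x y : ℝ) : ∀ p α, p = 1 - Real.exp (-t * blockWeight i) →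
      α = i.1.2 * x + Real.sqrt (1 - i.1.2 ^ 2) * y →
    expNeg (projOp blockWeight upperVec) t (lp.single 2 i (realVec x y)) =
      lp.single 2 i (realVec (x - p * α * i.1.2)
        (y - p * α * Real.sqrt (1 - i.1.2 ^ 2))) := by
  rintro p α rfl rfl
  rw [expNeg_projOp_single blockWeight_nonneg norm_upperVec ht, upperVec, inner_realVec,
    ← Complex.ofReal_mul, smul_realVec, realVec_sub]

theorem expNeg_lowerVec_single [DecidableEq BlockIndex] {t : ℝ} (ht : 0 ≤ t) (i : BlockIndex)
    (x y : ℝ) : ∀ p β, p = 1 - Real.exp (-t * blockWeight i) →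
      β = -i.1.2 * x + Real.sqrt (1 - i.1.2 ^ 2) * y →
    expNeg (projOp blockWeight lowerVec) t (lp.single 2 i (realVec x y)) =
      lp.single 2 i (realVec (x + p * β * i.1.2)
        (y - p * β * Real.sqrt (1 - i.1.2 ^ 2))) := by
  rintro p β rfl rfl
  rw [expNeg_projOp_single blockWeight_nonneg norm_lowerVec ht, lowerVec, inner_realVec,
    ← Complex.ofReal_mul, smul_realVec, realVec_sub]
  congr 2
  ring

/-- The two lines are mirror images in the second axis, so the off-diagonal entries of aa* + bb*
cancel and (1,0) is an eigenvector. -/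
theorem expNeg_add_single [DecidableEq BlockIndex] {t : ℝ} (ht : 0 ≤ t) (i : BlockIndex) :
    expNeg (projOp blockWeight upperVec + projOp blockWeight lowerVec) t
        (lp.single 2 i (realVec 1 0)) =
      (Real.exp (-t * (2 * blockWeight i * i.1.2 ^ 2)) : ℂ) • lp.single 2 i (realVec 1 0) := by
  have hS := (isNonnegSelfAdjoint_projOp blockWeight_nonneg).add
    (isNonnegSelfAdjoint_projOp blockWeight_nonneg) isSelfAdjoint_projOp_upperVec_add_lowerVec
  rw [projOp_upperVec_add_lowerVec] at hS ⊢
  refine hS.expNeg_apply_of_eigenvector (u := ⟨_, blockOp_single_mem _ i (realVec 1 0)⟩) ?_ ?_ ht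
  · have := blockWeight_nonneg i; positivity
  · rw [blockOp_single, ← lp.single_smul]
    congr 1
    simp only [add_apply, smul_apply, InnerProductSpace.rankOne_apply, upperVec, lowerVec,
      inner_realVec, smul_realVec, realVec_add]
    congr 1 <;> ring

end Optimality

/-! ### The lower bound for both products -/

section LowerBound

theorem exp_neg_four_mul_log_two : Real.exp (-(4 * Real.log 2)) = 1 / 16 := by
  rw [Real.exp_neg, show 4 * Real.log 2 = ((4 : ℕ) : ℝ) * Real.log 2 by norm_num,
    Real.exp_nat_mul, Real.exp_log two_pos]
  norm_num

theorem exp_neg_two_mul_log_two : Real.exp (-(2 * Real.log 2)) = 1 / 4 := by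
  rw [Real.exp_neg, show 2 * Real.log 2 = ((2 : ℕ) : ℝ) * Real.log 2 by norm_num,
    Real.exp_nat_mul, Real.exp_log two_pos]
  norm_num

/-- The two components of an eigenvector equation for the product of the one step semigroups. -/
theorem eigenvector_equations {s g l : ℝ} (hg : g ^ 2 = 1 - s ^ 2)
    (hl : l ^ 2 - (1 + 1 / 256) * l + 1 / 256 + 225 / 64 * (s ^ 2 * (1 - s ^ 2)) * l = 0) :
    ∀ x y α β, x = (15 * l - 15 / 16) * g * s → y = 1 - l - (15 / 16 + 15 * l) * s ^ 2 →
      α = s * x + g * y → β = -s * x + g * y →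
      x + 15 / 16 * β * s = l * (x + 15 * α * s) ∧
      y - 15 / 16 * β * g = l * (y + 15 * α * g) := by
  rintro x y α β rfl rfl rfl rfl
  constructor
  · ring
  · linear_combination 16 * hl + (225 / 4 * l * s ^ 2 - 225 / 16 * l + 15 * l ^ 2 - 15 / 16) * hg

/-- The cone |y| ≤ x guarantees an overlap of at least 1/2 with (1,0) after normalization. The last
two bounds concern the image under e^{-τB/2}, which is the eigenvector of the symmetric step. -/
theorem eigenvector_bounds {σ g l : ℝ} (hg0 : 0 ≤ g) (hg : g ^ 2 = 1 - σ ^ 2) (hσ0 : 0 < σ)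
    (hσ1 : σ ≤ 1 / 10) (hl1 : 1 - 4 * σ ^ 2 ≤ l) (hl2 : l ≤ 1) {x y β : ℝ}
    (hx : x = (15 * l - 15 / 16) * g * σ) (hy : y = 1 - l - (15 / 16 + 15 * l) * σ ^ 2)
    (hβ : β = -σ * x + g * y) :
    0 < x ∧ |y| ≤ x ∧ 0 < x + 3 / 4 * β * σ ∧ |y - 3 / 4 * β * g| ≤ x + 3 / 4 * β * σ := by
  have hs2 : σ ^ 2 ≤ 1 / 10 * σ := by nlinarith
  have hs3 : σ ^ 2 ≤ 1 / 100 := by nlinarith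
  have hg1 : g ≤ 1 := by nlinarith [sq_nonneg σ]
  have hg2 : 99 / 100 ≤ g := by nlinarith
  have hx1 : 13 * σ ≤ x := by
    have : 13 ≤ (15 * l - 15 / 16) * g := by nlinarith
    rw [hx]; exact mul_le_mul_of_nonneg_right this hσ0.le
  have hx2 : x ≤ 15 * σ := by
    have : (15 * l - 15 / 16) * g ≤ 15 := by nlinarith
    rw [hx]; exact mul_le_mul_of_nonneg_right this hσ0.le
  have hy1 : -(8 / 5 * σ) ≤ y := by rw [hy]; nlinarith
  have hy2 : y ≤ 8 / 5 * σ := by rw [hy]; nlinarith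
  have hgy1 : -(8 / 5 * σ) ≤ g * y := by nlinarith
  have hgy2 : g * y ≤ 8 / 5 * σ := by nlinarith
  have hβ1 : -(31 / 10 * σ) ≤ β := by rw [hβ]; nlinarith
  have hβ2 : β ≤ 31 / 10 * σ := by rw [hβ]; nlinarith
  have hgβ1 : -(31 / 10 * σ) ≤ g * β := by nlinarith
  have hgβ2 : g * β ≤ 31 / 10 * σ := by nlinarith
  have hβσ : -(31 / 100 * σ) ≤ β * σ := by nlinarith
  refine ⟨by linarith, abs_le.2 ⟨by linarith, by linarith⟩, by linarith,
    abs_le.2 ⟨by linarith, by linarith⟩⟩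

variable [DecidableEq BlockIndex] {i : BlockIndex} {t l σ : ℝ}

theorem norm_products_sub_ge (ht : 0 ≤ t) (hk : t * blockWeight i = 4 * Real.log 2)
    (hσ : i.1.2 = σ) (hσ0 : 0 < σ) (hσ1 : σ ≤ 1 / 10) (hl1 : 1 - 4 * σ ^ 2 ≤ l) (hl2 : l ≤ 1)
    (hl : l ^ 2 - (1 + 1 / 256) * l + 1 / 256 + 225 / 64 * (σ ^ 2 * (1 - σ ^ 2)) * l = 0)
    (n : ℕ) :
    (l ^ n - Real.exp (-(8 * Real.log 2 * σ ^ 2)) ^ n) / 2 ≤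
      ‖symmStep (projOp blockWeight upperVec) (projOp blockWeight lowerVec) t ^ n -
        expNeg (projOp blockWeight upperVec + projOp blockWeight lowerVec) (n * t)‖ ∧
    (l ^ n - Real.exp (-(8 * Real.log 2 * σ ^ 2)) ^ n) / 2 ≤
      ‖(expNeg (projOp blockWeight upperVec) t * expNeg (projOp blockWeight lowerVec) t) ^ n -
        expNeg (projOp blockWeight upperVec + projOp blockWeight lowerVec) (n * t)‖ := by
  have hA := isNonnegSelfAdjoint_projOp (a := upperVec) blockWeight_nonneg
  have hB := isNonnegSelfAdjoint_projOp (a := lowerVec) blockWeight_nonneg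
  have hS := hA.add hB isSelfAdjoint_projOp_upperVec_add_lowerVec
  have ht2 : 0 ≤ t / 2 := by positivity
  have hnt : 0 ≤ n * t := by positivity
  have hp : (15 / 16 : ℝ) = 1 - Real.exp (-t * blockWeight i) := by
    rw [neg_mul, hk, exp_neg_four_mul_log_two]; norm_num
  have hp2 : (3 / 4 : ℝ) = 1 - Real.exp (-(t / 2) * blockWeight i) := by
    rw [show -(t / 2) * blockWeight i = -(t * blockWeight i / 2) by ring, hk,
      show 4 * Real.log 2 / 2 = 2 * Real.log 2 by ring, exp_neg_two_mul_log_two]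
    norm_num
  obtain ⟨g, hgdef⟩ : ∃ g, g = Real.sqrt (1 - i.1.2 ^ 2) := ⟨_, rfl⟩
  have hg : g ^ 2 = 1 - σ ^ 2 := by rw [hgdef, sq_sqrt_one_sub, hσ]
  have hg0 : 0 ≤ g := hgdef ▸ Real.sqrt_nonneg _
  obtain ⟨x, hx⟩ : ∃ x, x = (15 * l - 15 / 16) * g * σ := ⟨_, rfl⟩
  obtain ⟨y, hy⟩ : ∃ y, y = 1 - l - (15 / 16 + 15 * l) * σ ^ 2 := ⟨_, rfl⟩
  obtain ⟨α, hα⟩ : ∃ α, α = σ * x + g * y := ⟨_, rfl⟩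
  obtain ⟨β, hβ⟩ : ∃ β, β = -σ * x + g * y := ⟨_, rfl⟩
  -- The eigenvector equation is used in the form e^{-τB}v = l e^{τA}v, where e^{τA} = 1 + 15aa* on
  -- the block since e^{τk} = 16.
  obtain ⟨e1, e2⟩ := eigenvector_equations hg hl x y α β hx hy hα hβ
  obtain ⟨hx1, hy1, hx2, hy2⟩ := eigenvector_bounds hg0 hg hσ0 hσ1 hl1 hl2 hx hy hβ
  -- the eigenvector of the nonsymmetric step
  have hQ : (expNeg (projOp blockWeight upperVec) t * expNeg (projOp blockWeight lowerVec) t)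
      (lp.single 2 i (realVec x y)) = (l : ℂ) • lp.single 2 i (realVec x y) := by
    rw [mul_apply_eq_comp, expNeg_lowerVec_single ht i x y (15 / 16) β hp (by rw [hβ, hσ, hgdef, hσ]),
      ← hgdef, hσ, e1, e2, expNeg_upperVec_single ht i _ _ (15 / 16) (l * (16 * α)) hp, ← hgdef, hσ,
      ← lp.single_smul, smul_realVec]
    · congr 2 <;> ring
    · rw [← hgdef, hσ]
      linear_combination l * hα - 15 * l * α * hg
  -- e^{-τB/2} intertwines the nonsymmetric step with the symmetric one, so the eigenvalue l is
  -- shared.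
  have hF : symmStep (projOp blockWeight upperVec) (projOp blockWeight lowerVec) t
      (expNeg (projOp blockWeight lowerVec) (t / 2) (lp.single 2 i (realVec x y))) =
      (l : ℂ) • expNeg (projOp blockWeight lowerVec) (t / 2) (lp.single 2 i (realVec x y)) := by
    rw [← map_smul, ← hQ, ← expNeg_half_mul_self hB ht, symmStep]
    simp only [mul_apply_eq_comp]
  have hH : expNeg (projOp blockWeight upperVec + projOp blockWeight lowerVec) (n * t)
      (lp.single 2 i (realVec 1 0)) = ((Real.exp (-(8 * Real.log 2 * σ ^ 2)) ^ n : ℝ) : ℂ) •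
      lp.single 2 i (realVec 1 0) := by
    rw [expNeg_add_single hnt, ← Real.exp_nat_mul, hσ]
    congr 3
    linear_combination (-2 * n * σ ^ 2) * hk
  have hHs : IsSelfAdjoint
      (expNeg (projOp blockWeight upperVec + projOp blockWeight lowerVec) (n * t)) :=
    IsSelfAdjoint.of_nonneg (hS.expNeg_nonneg hnt)
  have fin : ∀ (T : lp (fun _ : BlockIndex => EuclideanSpace ℂ (Fin 2)) 2 →L[ℂ]
      lp (fun _ : BlockIndex => EuclideanSpace ℂ (Fin 2)) 2) (x y : ℝ), 0 < x → |y| ≤ x →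
      T (lp.single 2 i (realVec x y)) = (l : ℂ) • lp.single 2 i (realVec x y) →
      (l ^ n - Real.exp (-(8 * Real.log 2 * σ ^ 2)) ^ n) / 2 ≤
        ‖T ^ n - expNeg (projOp blockWeight upperVec + projOp blockWeight lowerVec) (n * t)‖ := by
    intro T x y hx hyx hT
    have h := sub_mul_norm_inner_le hHs hT hH n
    rw [lp.inner_single_left, lp.single_apply_self, inner_realVec, lp.norm_single (by norm_num),
      lp.norm_single (by norm_num), norm_realVec_eq_one (by norm_num), Complex.norm_real,
      Real.norm_of_nonneg (by simpa using hx.le), one_mul, one_mul, zero_mul, add_zero] at h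
    have h2 : (l ^ n - Real.exp (-(8 * Real.log 2 * σ ^ 2)) ^ n) * x ≤
        ‖T ^ n - expNeg (projOp blockWeight upperVec + projOp blockWeight lowerVec) (n * t)‖ *
          (2 * x) := h.trans (by gcongr; exact norm_realVec_le hyx)
    rw [← mul_assoc] at h2
    linarith [le_of_mul_le_mul_right h2 hx]
  constructor
  · rw [expNeg_lowerVec_single ht2 i x y (3 / 4) β hp2 (by rw [hβ, hσ, hgdef, hσ]),
      ← hgdef, hσ] at hF
    exact fin _ _ _ hx2 hy2 hF
  · exact fin _ x y hx1 hy1 hQ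

theorem norm_products_sub_ge_div {n : ℕ} (hn : 1 ≤ n) {t : ℝ} (ht : 0 < t) :
    min t 1 ^ 2 / 400 / n ≤
      ‖symmProduct (projOp blockWeight upperVec) (projOp blockWeight lowerVec) n t -
        expNeg (projOp blockWeight upperVec + projOp blockWeight lowerVec) t‖ ∧
    min t 1 ^ 2 / 400 / n ≤
      ‖nonsymmProduct (projOp blockWeight upperVec) (projOp blockWeight lowerVec) n t -
        expNeg (projOp blockWeight upperVec + projOp blockWeight lowerVec) t‖ := by
  classical
  have hn1 : (1 : ℝ) ≤ n := by exact_mod_cast hn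
  have hm0 : 0 < min t 1 := lt_min ht one_pos
  have hm1 : min t 1 ≤ 1 := min_le_right _ _
  have hmt : min t 1 ≤ t := min_le_left _ _
  have hlog0 := Real.log_two_gt_d9
  have hlog1 := Real.log_two_lt_d9
  -- The minimum keeps kσ ≤ 1 for small t and σ ≤ 1/(10n) for large t. Half of nσ²/2 is then
  -- min(t,1)²/(400n), the overlap accounting for the extra half.
  obtain ⟨σ, hσ⟩ : ∃ σ, σ = min t 1 / (10 * n) := ⟨_, rfl⟩
  have hσ0 : 0 < σ := by rw [hσ]; positivity
  have hσn : σ ≤ 1 / (10 * n) := by rw [hσ]; gcongr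
  have hσ1 : σ ≤ 1 / 10 := hσn.trans (by
    rw [div_le_div_iff₀ (by positivity) (by positivity)]; linarith)
  have hkσ : 4 * Real.log 2 / (t / n) * σ ≤ 1 := by
    have e : 4 * Real.log 2 / (t / n) * σ = 4 * Real.log 2 * min t 1 / (10 * t) := by
      rw [hσ]; field_simp
    rw [e, div_le_one (by positivity)]
    nlinarith
  let i : BlockIndex := ⟨(4 * Real.log 2 / (t / n), σ),
    by positivity, hσ0.le, by linarith, hkσ⟩
  obtain ⟨l, hl1, hl2, hl⟩ := exists_eigenvalue hσ0.le hσ1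
  have htn : 0 < t / n := by positivity
  have hk : t / n * blockWeight i = 4 * Real.log 2 := by
    change t / n * (4 * Real.log 2 / (t / n)) = _
    field_simp
  have h := norm_products_sub_ge (i := i) htn.le hk rfl hσ0 hσ1 hl1 hl2 hl n
  have hlow := pow_sub_exp_pow_ge hn hσ0.le hσn hl1
  have hc : min t 1 ^ 2 / 400 / n = n * σ ^ 2 / 2 / 2 := by
    rw [hσ]; field_simp; norm_num
  have ht' : t = n * (t / n) := by field_simp
  rw [symmProduct_eq hn ht', nonsymmProduct_eq hn ht', hc]
  rw [← ht'] at h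
  exact ⟨le_trans (by gcongr) h.1, le_trans (by gcongr) h.2⟩

end LowerBound

end TrotterProduct

open TrotterProduct in
theorem theorem2p1 :
    -- convergence in operator norm with error `O(1/n)`
    (∀ (E : Type*) [NormedAddCommGroup E] [InnerProductSpace ℂ E] [CompleteSpace E]
      (A B : E →ₗ.[ℂ] E), IsNonnegSelfAdjoint A → IsNonnegSelfAdjoint B →
      -- the operator sum `A + B` has the domain `A.domain ⊓ B.domain`
      IsSelfAdjoint (A + B) →
        -- locally uniformly on `[0, ∞)`
        (∀ L : ℝ, 0 ≤ L → ∃ C : ℝ, ∀ n : ℕ, 1 ≤ n → ∀ t ∈ Set.Icc 0 L,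
          ‖symmProduct A B n t - expNeg (A + B) t‖ ≤ C / n ∧
          ‖nonsymmProduct A B n t - expNeg (A + B) t‖ ≤ C / n) ∧
        -- uniformly on `[0, ∞)` if the sum is strictly positive
        (HasPositiveLowerBound (A + B) → ∃ C : ℝ, ∀ n : ℕ, 1 ≤ n → ∀ t ∈ Set.Ici (0 : ℝ),
          ‖symmProduct A B n t - expNeg (A + B) t‖ ≤ C / n ∧
          ‖nonsymmProduct A B n t - expNeg (A + B) t‖ ≤ C / n)) ∧
    -- optimality of the error bound, for both products
    (∃ (E : Type) (_ : NormedAddCommGroup E) (_ : InnerProductSpace ℂ E) (_ : CompleteSpace E)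
      (A B : E →ₗ.[ℂ] E), IsNonnegSelfAdjoint A ∧ IsNonnegSelfAdjoint B ∧
      IsUnbounded A ∧ IsUnbounded B ∧ IsSelfAdjoint (A + B) ∧
      ∃ c : ℝ → ℝ, ContinuousOn c (Set.Ici 0) ∧ c 0 = 0 ∧ (∀ t : ℝ, 0 < t → 0 < c t) ∧
        ∀ n : ℕ, 1 ≤ n → ∀ t ∈ Set.Ici (0 : ℝ),
          c t / n ≤ ‖symmProduct A B n t - expNeg (A + B) t‖ ∧
          c t / n ≤ ‖nonsymmProduct A B n t - expNeg (A + B) t‖) := by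
  refine ⟨fun E _ _ _ A B hA hB hH => ⟨fun L hL => exists_error_bound_on_Icc hA hB hH hL,
    fun h => exists_error_bound_on_Ici hA hB hH h⟩, ?_⟩
  refine ⟨lp (fun _ : BlockIndex => EuclideanSpace ℂ (Fin 2)) 2, inferInstance, inferInstance,
    inferInstance, projOp blockWeight upperVec, projOp blockWeight lowerVec,
    isNonnegSelfAdjoint_projOp blockWeight_nonneg, isNonnegSelfAdjoint_projOp blockWeight_nonneg,
    isUnbounded_projOp norm_upperVec, isUnbounded_projOp norm_lowerVec,
    isSelfAdjoint_projOp_upperVec_add_lowerVec, fun t => min t 1 ^ 2 / 400, ?_, ?_, ?_, ?_⟩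
  · fun_prop
  · norm_num
  · intro t ht
    have : 0 < min t 1 := lt_min ht one_pos
    positivity
  · intro n hn t ht
    rcases (Set.mem_Ici.1 ht).eq_or_lt with rfl | ht
    · norm_num
    · exact norm_products_sub_ge_div hn ht
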